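/- Let $q\ge 1$ and let $\mu$ be a probability measure on the ordered alphabet $[q]=\{1,\dots,q\}$ that is not a point mass; write $p_x=\mu(\{x\})$, $L_x=\sum_{y<x}p_y$, $U_x=\sum_{y>x}p_y$, and $$\operatorname{Osc}(\mu)=\sum_{x\in[q]}\frac{L_x^2+U_x^2}{L_x+U_x}\,p_x .$$ For a word $a=(a_1,\dots,a_n)\in[q]^n$ let $\operatorname{LA}_n(a)$ be the largest $m$ for which there are indices $\ell_1<\dots<\ell_m$ with $a_{\ell_1}>a_{\ell_2}<a_{\ell_3}>\cdots a_{\ell_m}$, and let $\operatorname{LA}_n(\mu)$ denote $\operatorname{LA}_n(\boldsymbol a)$ for a word $\boldsymbol a=(\boldsymbol a_1,\dots,\boldsymbol a_n)$ of i.i.d. letters with law $\mu$. On $[q]^{\mathbb Z}$, equipped with the product measure $\mu^{\mathbb Z}$, let $(Ta)_i=a_{i+1}$ be the shift, and let $f(a)=2$ if $a$ has a local maximum at the index $0$, that is, if $a_j<a_{j+1}=\dots=a_0>a_1$ for some $j<0$, and $f(a)=0$ otherwise. Put $$\gamma^2=\operatorname{Cov}(f,f)+2\sum_{k=1}^{\infty}\operatorname{Cov}\bigl(f,f\circ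 T^{k}\bigr).$$ Theorem. The series defining $\gamma^2$ converges absolutely, $\gamma^2>0$, and with $\gamma=\sqrt{\gamma^2}$, as $n\to\infty$, $$\frac{\operatorname{LA}_n(\mu)-n\operatorname{Osc}(\mu)}{\sqrt n\,\gamma}\Longrightarrow \mathcal Z ,$$ where $\mathcal Z$ is a standard normal random variable and $\Longrightarrow$ denotes convergence in distribution. -/

import Mathlib

open MeasureTheory ProbabilityTheory Filter

namespace LongestAlternating

/-- A finite sequence `b₁, …, b_m` is alternating if `b₁ > b₂ < b₃ > b₄ < ⋯`
(positions are numbered from `0` in the code, so descents start at even positions). -/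
def IsAlternating {Λ : Type*} [LinearOrder Λ] {m : ℕ} (b : Fin m → Λ) : Prop :=
  ∀ (i : ℕ) (h : i + 1 < m),
    (Even i → b ⟨i + 1, h⟩ < b ⟨i, by lia⟩) ∧ (¬ Even i → b ⟨i, by lia⟩ < b ⟨i + 1, h⟩)

/-- The lengths of the alternating subsequences of the word `a`. -/
def alternatingLengths {Λ : Type*} [LinearOrder Λ] {n : ℕ} (a : Fin n → Λ) : Set ℕ :=
  {m | ∃ l : Fin m → Fin n, StrictMono l ∧ IsAlternating (a ∘ l)}

/-- The length of the longest alternating subsequence of the word `a`. -/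
noncomputable def LA {Λ : Type*} [LinearOrder Λ] {n : ℕ} (a : Fin n → Λ) : ℕ :=
  sSup (alternatingLengths a)

/-- `LA a` really is a maximum. -/
theorem isGreatest_LA {Λ : Type*} [LinearOrder Λ] {n : ℕ} (a : Fin n → Λ) :
    IsGreatest (alternatingLengths a) (LA a) := by
  have hb : BddAbove (alternatingLengths a) := by
    refine ⟨n, ?_⟩
    rintro m ⟨l, hl, -⟩
    simpa using Fintype.card_le_of_injective l hl.injective
  have hne : (alternatingLengths a).Nonempty :=
    ⟨0, Fin.elim0, fun i => i.elim0, fun i h => by omega⟩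
  exact ⟨Nat.sSup_mem hne hb, fun m hm => le_csSup hb hm⟩

section Oscillation

variable {q : ℕ} (μ : Measure (Fin q))

/-- `L_x = ∑_{y < x} p_y`. -/
noncomputable def lowerMass (x : Fin q) : ℝ := ∑ y ∈ Finset.Iio x, μ.real {y}

/-- `U_x = ∑_{y > x} p_y`. -/
noncomputable def upperMass (x : Fin q) : ℝ := ∑ y ∈ Finset.Ioi x, μ.real {y}

/-- The oscillation of `μ` at `x`. -/
noncomputable def oscAt (x : Fin q) : ℝ :=
  (lowerMass μ x ^ 2 + upperMass μ x ^ 2) / (lowerMass μ x + upperMass μ x)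

/-- The total oscillation of `μ`. -/
noncomputable def Osc : ℝ := ∑ x, oscAt μ x * μ.real {x}

end Oscillation

section Bilateral

variable {q : ℕ}

/-- The bilateral sequence `a` has a local maximum at the index `k`: for some `j < k`,
`a_j < a_{j+1} = ⋯ = a_k > a_{k+1}`. -/
def HasLocalMaxAt (a : ℤ → Fin q) (k : ℤ) : Prop :=
  ∃ j < k, a j < a (j + 1) ∧ (∀ i, j + 1 ≤ i → i ≤ k → a i = a k) ∧ a (k + 1) < a k

/-- The shift `(T a)_i = a_{i+1}` on bilateral sequences. -/
def shift (a : ℤ → Fin q) : ℤ → Fin q := fun i => a (i + 1)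

/-- Twice the indicator function of having a local maximum at the index `0`. -/
noncomputable def twiceLocalMax : (ℤ → Fin q) → ℝ :=
  Set.indicator {a | HasLocalMaxAt a 0} (fun _ => 2)

/-- The law `μ^ℤ` of a bilateral sequence of independent letters with law `μ`. -/
noncomputable def bilateralLaw (μ : Measure (Fin q)) [IsProbabilityMeasure μ] :
    Measure (ℤ → Fin q) :=
  Measure.infinitePi (fun _ : ℤ => μ)

/-- `Cov(f, T^{(k)} f)` under `μ^ℤ`, where `f = twiceLocalMax` and `T^{(k)} f = f ∘ T^k`. -/
noncomputable def lagCov (μ : Measure (Fin q)) [IsProbabilityMeasure μ] (k : ℕ) : ℝ :=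
  cov[twiceLocalMax, twiceLocalMax ∘ shift^[k]; bilateralLaw μ]

/-- `γ² = Cov(f, f) + 2 ∑_{k ≥ 1} Cov(f, T^{(k)} f)`. -/
noncomputable def gammaSq (μ : Measure (Fin q)) [IsProbabilityMeasure μ] : ℝ :=
  lagCov μ 0 + 2 * ∑' k : ℕ, lagCov μ (k + 1)

end Bilateral

end LongestAlternating

open LongestAlternating

/-! A greedy scan finds the longest alternating subsequence (`LA_eq_turns`). The scan is a finite
chain: its state is the last letter together with a flag telling whether the last change was
upwards. Up to an error of at most 1, `LA` is the sum along the chain of `peak`, which credits 2 to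
every descent read in an up state (`abs_LA_sub_pathSum_le`). So the theorem is a central limit
theorem for an additive functional of a finite chain.

Two distinct letters of positive weight, the larger read first, erase the initial state. Hence the
transition operator contracts oscillations geometrically, and Poisson's equation is solved by a
convergent series (`potential_eq`). Two such solutions g, k make 1 + itg + t²k an eigenvector of the
operator twisted by the characters of the increments, with eigenvalue exp(-t²s/2), up to O(|t|³).
After n steps the error is O(|t| + n|t|³) (`exists_norm_iterate_twisted_sub_le`), which vanishes for
t of order n^(-1/2); Lévy's continuity theorem concludes.

To identify the constants, the chain is run in stationarity along the bilateral sequence. The mean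
increment is `Osc μ` (`IsStationary.sum_peak`), and the lag covariances are integrals of iterates of
the transition operator, so their series sums to an expression in the corrector (`gammaSq_eq`). That
expression is the second moment of martingale increments; it is positive because rereading the
current letter fixes the state while the centred increment is -`Osc μ`, which is nonzero. -/

namespace LongestAlternating

/-! ### Geometric contraction for synchronizing chains -/

section Chain

variable {A S : Type*} [Fintype A]

/-- The transition operator of the chain that moves from `x` to `st x a` with probability `p a`. -/
noncomputable def avg (p : A → ℝ) (st : S → A → S) (h : S → ℝ) (x : S) : ℝ :=
  ∑ a, p a * h (st x a)

/-- The weights `p` form a probability vector, and two letters of positive weight, read one after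
the other, lead to a state that does not depend on the starting state. -/
structure IsSynchronizing (p : A → ℝ) (st : S → A → S) : Prop where
  nonneg : ∀ a, 0 ≤ p a
  sum_eq_one : ∑ a, p a = 1
  sync : ∃ u v, 0 < p u ∧ 0 < p v ∧ ∀ x y, st (st x u) v = st (st y u) v

/-- `π` is a stationary distribution of the chain. -/
structure IsStationary [Fintype S] (p : A → ℝ) (st : S → A → S) (π : S → ℝ) : Prop where
  nonneg : ∀ x, 0 ≤ π x
  sum_eq_one : ∑ x, π x = 1
  sum_avg : ∀ h : S → ℝ, ∑ x, π x * avg p st h x = ∑ x, π x * h x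

variable {p : A → ℝ} {st : S → A → S}

lemma avg_sub_avg_le (hp : IsSynchronizing p st) {h : S → ℝ} {c : ℝ}
    (hc : ∀ x y, |h x - h y| ≤ c) (x y : S) : |avg p st h x - avg p st h y| ≤ c := by
  have : avg p st h x - avg p st h y = ∑ a, p a * (h (st x a) - h (st y a)) := by
    simp [avg, mul_sub]
  rw [this]
  calc |∑ a, p a * (h (st x a) - h (st y a))| ≤ ∑ a, p a * c := by
        refine (Finset.abs_sum_le_sum_abs _ _).trans (Finset.sum_le_sum fun a _ => ?_)
        rw [abs_mul, abs_of_nonneg (hp.nonneg a)]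
        exact mul_le_mul_of_nonneg_left (hc _ _) (hp.nonneg a)
    _ = c := by rw [← Finset.sum_mul, hp.sum_eq_one, one_mul]

/-- Doeblin's argument: couple two copies of the chain by feeding them the same two letters; they
merge on the synchronizing pair. -/
lemma exists_avg_avg_contraction (hp : IsSynchronizing p st) :
    ∃ ρ : ℝ, 0 ≤ ρ ∧ ρ < 1 ∧ ∀ (h : S → ℝ) (c : ℝ), (∀ x y, |h x - h y| ≤ c) →
      ∀ x y, |avg p st (avg p st h) x - avg p st (avg p st h) y| ≤ ρ * c := by
  classical
  obtain ⟨u, v, hu, hv, huv⟩ := hp.sync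
  have hle : ∀ a, p a ≤ 1 := fun a => hp.sum_eq_one ▸
    Finset.single_le_sum (fun b _ => hp.nonneg b) (Finset.mem_univ a)
  -- The pair (u, v) contributes nothing to the difference, so its mass is lost from the bound.
  refine ⟨1 - p u * p v, ?_, by nlinarith [mul_pos hu hv], fun h c hc x y => ?_⟩
  · nlinarith [hle u, hle v]
  have hsum : ∑ a : A × A, p a.1 * p a.2 = 1 := by
    rw [Fintype.sum_prod_type]
    simp [← Finset.mul_sum, hp.sum_eq_one]
  have h1 : avg p st (avg p st h) x - avg p st (avg p st h) y =
      ∑ a : A × A, p a.1 * p a.2 * (h (st (st x a.1) a.2) - h (st (st y a.1) a.2)) := by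
    rw [Fintype.sum_prod_type]
    simp [avg, mul_sub, Finset.mul_sum, mul_assoc]
  have h2 : ∀ a : A × A, |p a.1 * p a.2 * (h (st (st x a.1) a.2) - h (st (st y a.1) a.2))| ≤
      p a.1 * p a.2 * c - if a = (u, v) then p u * p v * c else 0 := by
    intro a
    have h0 := mul_nonneg (hp.nonneg a.1) (hp.nonneg a.2)
    split_ifs with ha
    · subst ha; simp [huv x y]
    · rw [abs_mul, abs_of_nonneg h0, sub_zero]
      exact mul_le_mul_of_nonneg_left (hc _ _) h0
  rw [h1]
  refine (Finset.abs_sum_le_sum_abs _ _).trans ((Finset.sum_le_sum fun a _ => h2 a).trans_eq ?_)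
  rw [Finset.sum_sub_distrib, ← Finset.sum_mul, hsum]
  simp
  ring

lemma exists_iterate_avg_sub_le (hp : IsSynchronizing p st) :
    ∃ r : ℝ, 0 < r ∧ r < 1 ∧ ∀ (h : S → ℝ) (c : ℝ), 0 ≤ c → (∀ x y, |h x - h y| ≤ c) →
      ∀ k x y, |(avg p st)^[k] h x - (avg p st)^[k] h y| ≤ c / r * r ^ k := by
  obtain ⟨ρ, hρ0, hρ1, hρ⟩ := exists_avg_avg_contraction hp
  -- The contraction is per two steps; r is a rate per single step, and the prefactor 1/r pays for
  -- odd k.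
  obtain ⟨r, hr0, hr1, hr⟩ : ∃ r : ℝ, 0 < r ∧ r < 1 ∧ ρ ≤ r ^ 2 := by
    refine ⟨(1 + ρ) / 2, by linarith, by linarith, by nlinarith [sq_nonneg (1 - ρ)]⟩
  refine ⟨r, hr0, hr1, fun h c hc0 hc k => ?_⟩
  have hcr : 0 ≤ c / r := by positivity
  induction k using Nat.twoStepInduction with
  | zero =>
    intro x y
    refine (hc x y).trans ?_
    rw [pow_zero, mul_one, le_div_iff₀ hr0]
    nlinarith
  | one =>
    intro x y
    rw [pow_one, div_mul_cancel₀ _ hr0.ne']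
    exact avg_sub_avg_le hp hc x y
  | more k ih _ =>
    intro x y
    rw [Function.iterate_succ_apply', Function.iterate_succ_apply']
    refine (hρ _ _ ih x y).trans ?_
    rw [pow_add]
    have : 0 ≤ c / r * r ^ k := by positivity
    nlinarith

/-! ### Twisted operator and Taylor estimates -/

/-- The transition operator twisted by the character `e^{itF}` of the increments `F`. -/
noncomputable def twisted (p : A → ℝ) (st : S → A → S) (F : S → A → ℝ) (t : ℝ)
    (h : S → ℂ) (x : S) : ℂ :=
  ∑ a, p a * Complex.exp (Complex.I * t * F x a) * h (st x a)

lemma twisted_sub (F : S → A → ℝ) (t : ℝ) (g h : S → ℂ) :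
    twisted p st F t (g - h) = twisted p st F t g - twisted p st F t h := by
  ext x; simp [twisted, mul_sub]

lemma twisted_smul (F : S → A → ℝ) (t : ℝ) (c : ℂ) (h : S → ℂ) :
    twisted p st F t (c • h) = c • twisted p st F t h := by
  ext x
  simp only [twisted, Pi.smul_apply, smul_eq_mul, Finset.mul_sum]
  exact Finset.sum_congr rfl fun a _ => by ring

lemma norm_twisted_le (hp : IsSynchronizing p st) (F : S → A → ℝ) (t : ℝ) {h : S → ℂ} {c : ℝ}
    (hc : ∀ x, ‖h x‖ ≤ c) (x : S) : ‖twisted p st F t h x‖ ≤ c := by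
  refine (norm_sum_le_of_le _ (fun a _ => ?_)).trans_eq
    (show ∑ a, p a * c = c by rw [← Finset.sum_mul, hp.sum_eq_one, one_mul])
  have : ‖Complex.exp (Complex.I * t * F x a)‖ = 1 := by
    rw [Complex.norm_exp]; simp
  rw [norm_mul, norm_mul, this, Complex.norm_real, Real.norm_of_nonneg (hp.nonneg a), mul_one]
  exact mul_le_mul_of_nonneg_left (hc _) (hp.nonneg a)

lemma norm_iterate_twisted_le (hp : IsSynchronizing p st) (F : S → A → ℝ) (t : ℝ) {h : S → ℂ}
    {c : ℝ} (hc : ∀ x, ‖h x‖ ≤ c) (n : ℕ) (x : S) : ‖(twisted p st F t)^[n] h x‖ ≤ c := by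
  induction n generalizing x with
  | zero => exact hc x
  | succ n ih => rw [Function.iterate_succ_apply']; exact norm_twisted_le hp F t ih x

/-- Second-order expansion in t of a product: (itb)(itg) gives -bg and (itb)²/2 gives -b²/2.
Everything else has order at least 3, and higher powers are absorbed by |t| ≤ 1. -/
lemma norm_exp_mul_quadratic_sub_le (b g k t : ℝ) (ht : |t| ≤ 1) :
    ‖Complex.exp (Complex.I * t * b) * (1 + Complex.I * t * g + t ^ 2 * k) -
      (1 + Complex.I * t * (b + g) + t ^ 2 * (k - b * g - b ^ 2 / 2))‖ ≤
      (|b| ^ 3 * Real.exp |b| * (1 + |g| + |k|) + |b| * |k| + b ^ 2 * |g| + b ^ 2 * |k|)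
        * |t| ^ 3 := by
  have h0 := abs_nonneg t
  set z : ℂ := Complex.I * t * b with hz
  have hzn : ‖z‖ = |t| * |b| := by simp [hz]
  have hr := Complex.norm_exp_sub_sum_le_norm_mul_exp z 3
  simp only [Finset.sum_range_succ, Finset.sum_range_zero, hzn] at hr
  set r := Complex.exp z - (0 + z ^ 0 / (Nat.factorial 0 : ℕ) + z ^ 1 / (Nat.factorial 1 : ℕ)
    + z ^ 2 / (Nat.factorial 2 : ℕ)) with hrdef
  have he : Real.exp (|t| * |b|) ≤ Real.exp |b| :=
    Real.exp_le_exp.2 (by nlinarith [abs_nonneg b])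
  have hr' : ‖r‖ ≤ |t| ^ 3 * (|b| ^ 3 * Real.exp |b|) := by
    refine hr.trans ?_
    rw [mul_pow, mul_assoc]
    gcongr
  have ht2 : |t| ^ 2 ≤ 1 := pow_le_one₀ h0 ht
  have hq : ‖(1 + Complex.I * t * g + t ^ 2 * k : ℂ)‖ ≤ 1 + |g| + |k| := by
    refine (norm_add₃_le).trans ?_
    simp only [norm_one, norm_mul, norm_pow, Complex.norm_I, Complex.norm_real, Real.norm_eq_abs,
      one_mul]
    have := mul_le_of_le_one_left (abs_nonneg g) ht
    have := mul_le_of_le_one_left (abs_nonneg k) ht2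
    linarith
  -- These are the terms of order 3 and 4 left when the exponential is replaced by its quadratic
  -- Taylor polynomial.
  have hs : ‖(t : ℂ) ^ 3 * (Complex.I * b * k - Complex.I * b ^ 2 * g / 2 - t * b ^ 2 * k / 2)‖
      ≤ |t| ^ 3 * (|b| * |k| + b ^ 2 * |g| + b ^ 2 * |k|) := by
    rw [norm_mul, norm_pow, Complex.norm_real, Real.norm_eq_abs]
    refine mul_le_mul_of_nonneg_left ?_ (by positivity)
    refine (norm_sub_le _ _).trans ((add_le_add_left (norm_sub_le _ _) _).trans ?_)
    simp only [norm_mul, norm_pow, norm_div, Complex.norm_I, Complex.norm_real, Real.norm_eq_abs,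
      one_mul, sq_abs, Complex.norm_ofNat]
    have h1 : 0 ≤ b ^ 2 * |g| := by positivity
    have h2 : 0 ≤ b ^ 2 * |k| := by positivity
    have h3 : |t| * (b ^ 2 * |k|) ≤ b ^ 2 * |k| := mul_le_of_le_one_left h2 ht
    have h4 : |t| * b ^ 2 * |k| = |t| * (b ^ 2 * |k|) := by ring
    rw [h4]
    linarith
  have hI : Complex.I ^ 2 = -1 := Complex.I_sq
  have heq : Complex.exp z * (1 + Complex.I * t * g + t ^ 2 * k) -
      (1 + Complex.I * t * (b + g) + t ^ 2 * (k - b * g - b ^ 2 / 2)) =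
      r * (1 + Complex.I * t * g + t ^ 2 * k) +
      (t : ℂ) ^ 3 * (Complex.I * b * k - Complex.I * b ^ 2 * g / 2 - t * b ^ 2 * k / 2) := by
    simp only [hrdef, hz, Nat.factorial]
    push_cast
    linear_combination (t ^ 2 * b * g + t ^ 2 * b ^ 2 / 2 * (1 + Complex.I * t * g + t ^ 2 * k)) * hI
  rw [heq]
  refine (norm_add_le _ _).trans ?_
  rw [norm_mul]
  have := mul_le_mul hr' hq (norm_nonneg _) (by positivity)
  linarith

lemma norm_exp_sq_mul_quadratic_sub_le (s g k t : ℝ) (ht : |t| ≤ 1) :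
    ‖Complex.exp (-(t ^ 2 * s / 2)) * (1 + Complex.I * t * g + t ^ 2 * k) -
      (1 + Complex.I * t * g + t ^ 2 * (k - s / 2))‖ ≤
      (s ^ 2 * Real.exp |s| * (1 + |g| + |k|) + |s| * |g| + |s| * |k|) * |t| ^ 3 := by
  have h0 := abs_nonneg t
  have ht2 : |t| ^ 2 ≤ 1 := pow_le_one₀ h0 ht
  set z : ℂ := -(t ^ 2 * s / 2) with hz
  have hzn : ‖z‖ = |t| ^ 2 * |s| / 2 := by simp [hz]
  have hr := Complex.norm_exp_sub_sum_le_norm_mul_exp z 2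
  simp only [Finset.sum_range_succ, Finset.sum_range_zero, hzn] at hr
  set r := Complex.exp z - (0 + z ^ 0 / (Nat.factorial 0 : ℕ) + z ^ 1 / (Nat.factorial 1 : ℕ))
    with hrdef
  have hts : |t| ^ 2 * |s| ≤ |s| := mul_le_of_le_one_left (abs_nonneg s) ht2
  have he : Real.exp (|t| ^ 2 * |s| / 2) ≤ Real.exp |s| :=
    Real.exp_le_exp.2 (by linarith [abs_nonneg s])
  have ht43 : |t| ^ 4 ≤ |t| ^ 3 := pow_le_pow_of_le_one h0 ht (by norm_num)
  have hr' : ‖r‖ ≤ |t| ^ 3 * (s ^ 2 * Real.exp |s|) := by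
    refine hr.trans ?_
    have : (|t| ^ 2 * |s| / 2) ^ 2 ≤ |t| ^ 3 * s ^ 2 := by
      have h1 : (|t| ^ 2 * |s| / 2) ^ 2 = |t| ^ 4 * s ^ 2 / 4 := by
        rw [div_pow, mul_pow, sq_abs s]; ring
      rw [h1]
      have := mul_le_mul_of_nonneg_right ht43 (sq_nonneg s)
      have : 0 ≤ |t| ^ 4 * s ^ 2 := by positivity
      linarith
    rw [← mul_assoc]
    exact mul_le_mul this he (Real.exp_nonneg _) (by positivity)
  have hq : ‖(1 + Complex.I * t * g + t ^ 2 * k : ℂ)‖ ≤ 1 + |g| + |k| := by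
    refine (norm_add₃_le).trans ?_
    simp only [norm_one, norm_mul, norm_pow, Complex.norm_I, Complex.norm_real, Real.norm_eq_abs,
      one_mul]
    have := mul_le_of_le_one_left (abs_nonneg g) ht
    have := mul_le_of_le_one_left (abs_nonneg k) ht2
    linarith
  have hs : ‖(t : ℂ) ^ 3 * (-(Complex.I * s * g / 2) - t * s * k / 2)‖
      ≤ |t| ^ 3 * (|s| * |g| + |s| * |k|) := by
    rw [norm_mul, norm_pow, Complex.norm_real, Real.norm_eq_abs]
    refine mul_le_mul_of_nonneg_left ?_ (by positivity)
    refine (norm_sub_le _ _).trans ?_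
    simp only [norm_neg, norm_mul, norm_div, Complex.norm_I, Complex.norm_real, Real.norm_eq_abs,
      one_mul, Complex.norm_ofNat]
    have h1 : 0 ≤ |s| * |g| := by positivity
    have h2 : 0 ≤ |s| * |k| := by positivity
    have h3 : |t| * (|s| * |k|) ≤ |s| * |k| := mul_le_of_le_one_left h2 ht
    have h4 : |t| * |s| * |k| = |t| * (|s| * |k|) := by ring
    rw [h4]
    linarith
  have heq : Complex.exp z * (1 + Complex.I * t * g + t ^ 2 * k) -
      (1 + Complex.I * t * g + t ^ 2 * (k - s / 2)) =
      r * (1 + Complex.I * t * g + t ^ 2 * k) +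
      (t : ℂ) ^ 3 * (-(Complex.I * s * g / 2) - t * s * k / 2) := by
    simp only [hrdef, hz, Nat.factorial]
    push_cast
    ring
  rw [heq]
  refine (norm_add_le _ _).trans ?_
  rw [norm_mul]
  have := mul_le_mul hr' hq (norm_nonneg _) (by positivity)
  linarith

/-! ### Poisson equation and approximate eigenvectors -/

variable [Fintype S] {π : S → ℝ}

lemma IsStationary.sum_iterate_avg (hπ : IsStationary p st π) (h : S → ℝ) (k : ℕ) :
    ∑ x, π x * (avg p st)^[k] h x = ∑ x, π x * h x := by
  induction k generalizing h with
  | zero => rfl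
  | succ k ih => rw [Function.iterate_succ_apply, ih, hπ.sum_avg]

/-- Centred functions decay geometrically under the transition operator. -/
lemma exists_abs_iterate_avg_le (hp : IsSynchronizing p st) (hπ : IsStationary p st π) :
    ∃ r : ℝ, 0 < r ∧ r < 1 ∧ ∀ h : S → ℝ, ∑ x, π x * h x = 0 →
      ∃ C : ℝ, ∀ k x, |(avg p st)^[k] h x| ≤ C * r ^ k := by
  obtain ⟨r, hr0, hr1, hr⟩ := exists_iterate_avg_sub_le hp
  refine ⟨r, hr0, hr1, fun h hh => ?_⟩
  have hc : ∀ x y, |h x - h y| ≤ ∑ z, 2 * |h z| := fun x y => by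
    have hx := Finset.single_le_sum (fun z _ => abs_nonneg (h z)) (Finset.mem_univ x)
    have hy := Finset.single_le_sum (fun z _ => abs_nonneg (h z)) (Finset.mem_univ y)
    rw [← Finset.mul_sum]
    linarith [abs_sub (h x) (h y)]
  refine ⟨(∑ z, 2 * |h z|) / r, fun k x => ?_⟩
  · have key := hr h _ (Finset.sum_nonneg fun z _ => by positivity) hc k
    -- Stationarity keeps the π-mean at zero, so a bound on oscillations bounds the values.
    have : (avg p st)^[k] h x = ∑ y, π y * ((avg p st)^[k] h x - (avg p st)^[k] h y) := by
      simp only [mul_sub, Finset.sum_sub_distrib, ← Finset.sum_mul]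
      rw [hπ.sum_eq_one, hπ.sum_iterate_avg, hh]
      ring
    rw [this]
    refine (Finset.abs_sum_le_sum_abs _ _).trans ((Finset.sum_le_sum
      (g := fun y => π y * ((∑ z, 2 * |h z|) / r * r ^ k)) fun y _ => ?_).trans_eq ?_)
    · rw [abs_mul, abs_of_nonneg (hπ.nonneg y)]
      exact mul_le_mul_of_nonneg_left (key x y) (hπ.nonneg y)
    · rw [← Finset.sum_mul, hπ.sum_eq_one, one_mul]

/-- The potential of a function: a solution of the Poisson equation. -/
noncomputable def potential (p : A → ℝ) (st : S → A → S) (h : S → ℝ) (x : S) : ℝ :=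
  ∑' k, (avg p st)^[k] h x

lemma hasSum_potential (hp : IsSynchronizing p st) (hπ : IsStationary p st π) {h : S → ℝ}
    (hh : ∑ x, π x * h x = 0) (x : S) :
    HasSum (fun k => (avg p st)^[k] h x) (potential p st h x) := by
  obtain ⟨r, hr0, hr1, hr⟩ := exists_abs_iterate_avg_le hp hπ
  obtain ⟨C, hC⟩ := hr h hh
  exact (Summable.of_norm_bounded ((summable_geometric_of_lt_one hr0.le hr1).mul_left C)
    fun k => hC k x).hasSum

lemma potential_eq (hp : IsSynchronizing p st) (hπ : IsStationary p st π) {h : S → ℝ}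
    (hh : ∑ x, π x * h x = 0) (x : S) :
    potential p st h x = h x + avg p st (potential p st h) x := by
  have h1 : HasSum (fun k => (avg p st)^[k + 1] h x) (avg p st (potential p st h) x) := by
    simp only [Function.iterate_succ_apply']
    exact hasSum_sum fun a _ => (hasSum_potential hp hπ hh (st x a)).mul_left (p a)
  have h2 := (hasSum_nat_add_iff' 1).2 (hasSum_potential hp hπ hh x)
  have := h1.unique h2
  simp at this
  linarith

/-- If `1 + itg + t²k` solves the eigenvalue equation of the twisted operator up to the second
order, then it is an approximate eigenvector with eigenvalue `e^{-t²s/2}`. -/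
lemma exists_norm_twisted_sub_le (hp : IsSynchronizing p st) (F : S → A → ℝ) (g k : S → ℝ) (s : ℝ)
    (h1 : ∀ x, g x = ∑ a, p a * (F x a + g (st x a)))
    (h2 : ∀ x, k x - s / 2 = ∑ a, p a * (k (st x a) - F x a * g (st x a) - F x a ^ 2 / 2)) :
    ∃ C : ℝ, 0 ≤ C ∧ ∀ t : ℝ, |t| ≤ 1 → ∀ x,
      ‖twisted p st F t (fun x => 1 + Complex.I * t * g x + t ^ 2 * k x) x -
        Complex.exp (-(t ^ 2 * s / 2)) * (1 + Complex.I * t * g x + t ^ 2 * k x)‖ ≤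
        C * |t| ^ 3 := by
  let c₁ : S → A → ℝ := fun x a => |F x a| ^ 3 * Real.exp |F x a| *
    (1 + |g (st x a)| + |k (st x a)|) + |F x a| * |k (st x a)| + F x a ^ 2 * |g (st x a)| +
    F x a ^ 2 * |k (st x a)|
  let c₂ : S → ℝ := fun x => s ^ 2 * Real.exp |s| * (1 + |g x| + |k x|) + |s| * |g x| +
    |s| * |k x|
  have hc₁ : ∀ x a, 0 ≤ c₁ x a := fun x a => by positivity
  have hc₂ : ∀ x, 0 ≤ c₂ x := fun x => by positivity
  have hc : ∀ x, 0 ≤ ∑ a, p a * c₁ x a + c₂ x := fun x =>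
    add_nonneg (Finset.sum_nonneg fun a _ => mul_nonneg (hp.nonneg a) (hc₁ x a)) (hc₂ x)
  refine ⟨∑ x, (∑ a, p a * c₁ x a + c₂ x), Finset.sum_nonneg fun x _ => hc x, fun t ht x => ?_⟩
  refine le_trans ?_ (mul_le_mul_of_nonneg_right
    (Finset.single_le_sum (fun x _ => hc x) (Finset.mem_univ x)) (by positivity))
  -- M is the common Taylor polynomial of degree 2: `h1` and `h2` match the coefficients of t and t²
  -- on both sides.
  set M : ℂ := 1 + Complex.I * t * g x + t ^ 2 * ((k x : ℂ) - s / 2) with hM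
  have hM' : M = ∑ a, (p a : ℂ) * (1 + Complex.I * t * (F x a + g (st x a)) +
      t ^ 2 * (k (st x a) - F x a * g (st x a) - F x a ^ 2 / 2)) := by
    have e1 : (g x : ℂ) = ∑ a, (p a : ℂ) * (F x a + g (st x a)) := by
      rw [h1 x]; push_cast; rfl
    have e2 : (k x : ℂ) - s / 2 = ∑ a, (p a : ℂ) *
        (k (st x a) - F x a * g (st x a) - F x a ^ 2 / 2) := by
      have := congrArg (fun y : ℝ => (y : ℂ)) (h2 x)
      push_cast at this
      exact this
    have e0 : (1 : ℂ) = ∑ a, (p a : ℂ) := by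
      rw [← Complex.ofReal_sum, hp.sum_eq_one, Complex.ofReal_one]
    rw [hM, e1, e2]
    nth_rewrite 1 [e0]
    simp only [mul_add, Finset.sum_add_distrib, Finset.mul_sum]
    congr 1
    · congr 1
      · simp
      · rw [← Finset.sum_add_distrib, ← Finset.sum_add_distrib]
        exact Finset.sum_congr rfl fun a _ => by ring
    · exact Finset.sum_congr rfl fun a _ => by ring
  have d1 : ‖twisted p st F t (fun x => 1 + Complex.I * t * g x + t ^ 2 * k x) x - M‖ ≤
      (∑ a, p a * c₁ x a) * |t| ^ 3 := by
    rw [hM', twisted, ← Finset.sum_sub_distrib, Finset.sum_mul]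
    refine norm_sum_le_of_le _ fun a _ => ?_
    rw [mul_assoc (p a : ℂ), ← mul_sub, norm_mul, Complex.norm_real,
      Real.norm_of_nonneg (hp.nonneg a), mul_assoc (p a)]
    have := norm_exp_mul_quadratic_sub_le (F x a) (g (st x a)) (k (st x a)) t ht
    exact mul_le_mul_of_nonneg_left this (hp.nonneg a)
  have d2 := norm_exp_sq_mul_quadratic_sub_le s (g x) (k x) t ht
  rw [← hM] at d2
  refine (norm_sub_le_norm_sub_add_norm_sub _ M _).trans ?_
  rw [norm_sub_rev M, add_mul]
  exact add_le_add d1 d2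

/-- The iterates of the twisted operator are Gaussian up to an explicit error. -/
theorem exists_norm_iterate_twisted_sub_le (hp : IsSynchronizing p st) (F : S → A → ℝ)
    (g k : S → ℝ) {s : ℝ} (hs : 0 ≤ s)
    (h1 : ∀ x, g x = ∑ a, p a * (F x a + g (st x a)))
    (h2 : ∀ x, k x - s / 2 = ∑ a, p a * (k (st x a) - F x a * g (st x a) - F x a ^ 2 / 2)) :
    ∃ C : ℝ, 0 ≤ C ∧ ∀ t : ℝ, |t| ≤ 1 → ∀ (n : ℕ) x,
      ‖(twisted p st F t)^[n] 1 x - Complex.exp (-(t ^ 2 * s / 2)) ^ n‖ ≤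
        C * (|t| + n * |t| ^ 3) := by
  obtain ⟨C, hC0, hC⟩ := exists_norm_twisted_sub_le hp F g k s h1 h2
  set B := ∑ x, (|g x| + |k x|) with hB
  have hB0 : 0 ≤ B := Finset.sum_nonneg fun x _ => by positivity
  refine ⟨C + 2 * B, by positivity, fun t ht n x => ?_⟩
  set e : S → ℂ := fun x => 1 + Complex.I * t * g x + t ^ 2 * k x with he
  set lam := Complex.exp (-(t ^ 2 * s / 2)) with hlam
  have hlam1 : ‖lam‖ ≤ 1 := by
    rw [hlam, Complex.norm_exp]
    refine Real.exp_le_one_iff.2 ?_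
    have : (-((t : ℂ) ^ 2 * s / 2)).re = -(t ^ 2 * s / 2) := by
      norm_cast
    rw [this]
    have : 0 ≤ t ^ 2 * s := by positivity
    linarith
  have he1 : ∀ x, ‖e x - 1‖ ≤ B * |t| := fun x => by
    have : e x - 1 = Complex.I * t * g x + t ^ 2 * k x := by simp only [he]; ring
    rw [this]
    refine (norm_add_le _ _).trans ?_
    simp only [norm_mul, norm_pow, Complex.norm_I, Complex.norm_real, Real.norm_eq_abs, one_mul]
    have h3 := Finset.single_le_sum (f := fun x => |g x| + |k x|) (fun x _ => by positivity)
      (Finset.mem_univ x)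
    have h4 : |t| ^ 2 * |k x| ≤ |t| * |k x| := by
      refine mul_le_mul_of_nonneg_right ?_ (abs_nonneg _)
      rw [sq]; exact mul_le_of_le_one_left (abs_nonneg t) ht
    have h5 := mul_le_mul_of_nonneg_right h3 (abs_nonneg t)
    rw [← hB] at h5
    linarith
  -- The one-step errors only add up, since the twisted operator does not increase the sup norm and
  -- |lam| ≤ 1.
  have hiter : ∀ n x, ‖(twisted p st F t)^[n] e x - lam ^ n * e x‖ ≤ n * (C * |t| ^ 3) := by
    intro n
    induction n with
    | zero => intro x; simp
    | succ n ih =>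
      intro x
      rw [Function.iterate_succ_apply']
      have e1 : twisted p st F t ((twisted p st F t)^[n] e) x - lam ^ (n + 1) * e x =
          twisted p st F t ((twisted p st F t)^[n] e - lam ^ n • e) x +
          lam ^ n * (twisted p st F t e x - lam * e x) := by
        rw [twisted_sub, twisted_smul]
        simp
        ring
      rw [e1]
      refine (norm_add_le _ _).trans ?_
      have a1 := norm_twisted_le hp F t (h := (twisted p st F t)^[n] e - lam ^ n • e) ih x
      have a2 : ‖lam ^ n * (twisted p st F t e x - lam * e x)‖ ≤ C * |t| ^ 3 := by
        rw [norm_mul, norm_pow]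
        exact (mul_le_of_le_one_left (norm_nonneg _) (pow_le_one₀ (norm_nonneg _) hlam1)).trans
          (hC t ht x)
      push_cast
      linarith
  have hsub : ∀ n, (twisted p st F t)^[n] e - (twisted p st F t)^[n] 1 =
      (twisted p st F t)^[n] (e - 1) := by
    intro n
    induction n with
    | zero => rfl
    | succ n ih => simp only [Function.iterate_succ_apply', ← ih, twisted_sub]
  have b1 : ‖(twisted p st F t)^[n] e x - (twisted p st F t)^[n] 1 x‖ ≤ B * |t| := by
    have := congrFun (hsub n) x
    simp only [Pi.sub_apply] at this
    rw [this]
    exact norm_iterate_twisted_le hp F t he1 n x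
  have b2 := hiter n x
  have b3 : ‖lam ^ n * (e x - 1)‖ ≤ B * |t| := by
    rw [norm_mul, norm_pow]
    exact (mul_le_of_le_one_left (norm_nonneg _) (pow_le_one₀ (norm_nonneg _) hlam1)).trans
      (he1 x)
  have e2 : (twisted p st F t)^[n] 1 x - lam ^ n =
      -((twisted p st F t)^[n] e x - (twisted p st F t)^[n] 1 x) +
      ((twisted p st F t)^[n] e x - lam ^ n * e x) + lam ^ n * (e x - 1) := by ring
  rw [e2]
  refine norm_add₃_le.trans ?_
  rw [norm_neg]
  have h6 : 0 ≤ C * |t| := by positivity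
  have h7 : 0 ≤ 2 * B * (n * |t| ^ 3) := by positivity
  linarith

end Chain

/-! ### The greedy scan and alternating subsequences -/

section Turns

variable {Λ : Type*} [LinearOrder Λ]

/-- `AltEnd a m i`: some alternating subsequence of `a` of length `m` ends at the index `i`. -/
inductive AltEnd (a : ℕ → Λ) : ℕ → ℕ → Prop
  | single (i : ℕ) : AltEnd a 1 i
  | snoc {m i j : ℕ} (h : AltEnd a m i) (hij : i < j) (hodd : Odd m → a j < a i)
      (heven : Even m → a i < a j) : AltEnd a (m + 1) j

/-- The greedy count of the turning points of `a` up to the index `n`. -/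
def turns (a : ℕ → Λ) : ℕ → ℕ
  | 0 => 1
  | n + 1 => if (Odd (turns a n) ∧ a (n + 1) < a n) ∨ (Even (turns a n) ∧ a n < a (n + 1)) then
      turns a n + 1 else turns a n

lemma one_le_turns (a : ℕ → Λ) (n : ℕ) : 1 ≤ turns a n := by
  induction n with
  | zero => rfl
  | succ n ih => rw [turns]; split_ifs <;> omega

/-- If the new letter is not a turn, it continues or repeats the current direction, so the last
chosen index can be moved to it. -/
lemma altEnd_turns (a : ℕ → Λ) (n : ℕ) : AltEnd a (turns a n) n := by
  induction n with
  | zero => exact .single 0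
  | succ n ih =>
    rw [turns]
    split_ifs with h
    · refine .snoc ih n.lt_succ_self (fun ho => ?_) (fun he => ?_)
      · rcases h with h | h
        · exact h.2
        · exact absurd ho (Nat.not_odd_iff_even.2 h.1)
      · rcases h with h | h
        · exact absurd he (Nat.not_even_iff_odd.2 h.1)
        · exact h.2
    · push Not at h
      generalize turns a n = m at *
      cases ih with
      | single => exact .single _
      | snoc h' hij hodd heven =>
        refine .snoc h' (hij.trans n.lt_succ_self) (fun ho => ?_) (fun he => ?_)
        · exact (h.2 ho.add_one).trans_lt (hodd ho)
        · exact (heven he).trans_le (h.1 he.add_one)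

/-- The induction needs extremality as well: among the subsequences of maximal length, none ends at
a more extreme letter than a n. So any letter extending one of them is also a turn for the greedy
count. -/
lemma AltEnd.le_turns {a : ℕ → Λ} (n : ℕ) : ∀ {m i : ℕ}, AltEnd a m i → i ≤ n →
    m ≤ turns a n ∧ (m = turns a n → Odd m → a i ≤ a n) ∧
      (m = turns a n → Even m → a n ≤ a i) := by
  induction n with
  | zero =>
    intro m i h hi
    obtain rfl : i = 0 := by omega
    cases h with
    | single => simp [turns]
    | snoc _ hij => omega
  | succ n ih =>
    intro m i h hi
    have hstep : turns a n ≤ turns a (n + 1) := by rw [turns]; split_ifs <;> omega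
    rcases Nat.lt_or_ge n i with hlt | hle
    · obtain rfl : i = n + 1 := by omega
      refine ⟨?_, fun _ _ => le_rfl, fun _ _ => le_rfl⟩
      cases h with
      | single => exact one_le_turns _ _
      | @snoc m i _ h' hij hodd heven =>
        obtain ⟨h1, h2, h3⟩ := ih h' (by omega)
        rcases h1.lt_or_eq with h1 | h1
        · omega
        · rw [turns, if_pos]
          · omega
          · rw [← h1]
            rcases Nat.even_or_odd m with he | ho
            · exact .inr ⟨he, (h3 h1 he).trans_lt (heven he)⟩
            · exact .inl ⟨ho, (hodd ho).trans_le (h2 h1 ho)⟩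
    · obtain ⟨h1, h2, h3⟩ := ih h hle
      refine ⟨h1.trans hstep, ?_⟩
      rw [turns]
      split_ifs with hc
      · exact ⟨fun _ => by omega, fun _ => by omega⟩
      · push Not at hc
        refine ⟨fun hm ho => (h2 hm ho).trans (hc.1 (hm ▸ ho)),
          fun hm he => (hc.2 (hm ▸ he)).trans (h3 hm he)⟩

lemma AltEnd.exists_strictMono {a : ℕ → Λ} {m i : ℕ} (h : AltEnd a m i) :
    ∃ l : ℕ → ℕ, 0 < m ∧ l (m - 1) = i ∧ (∀ k, k + 1 < m → l k < l (k + 1)) ∧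
      (∀ k < m, l k ≤ i) ∧ ∀ k, k + 1 < m →
        (Even k → a (l (k + 1)) < a (l k)) ∧ (¬ Even k → a (l k) < a (l (k + 1))) := by
  induction h with
  | single i => exact ⟨fun _ => i, by simp⟩
  | @snoc m i j _ hij hodd heven ih =>
    obtain ⟨l, hm, hl, hmono, hle, halt⟩ := ih
    refine ⟨Function.update l m j, by omega, by simp, fun k hk => ?_, fun k hk => ?_,
      fun k hk => ?_⟩
    · rcases Nat.lt_or_ge (k + 1) m with h | h
      · rw [Function.update_of_ne (by omega), Function.update_of_ne (by omega)]
        exact hmono k h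
      · obtain rfl : m = k + 1 := by omega
        rw [Function.update_of_ne (a := k) (by omega), Function.update_self]
        simp only [Nat.add_sub_cancel] at hl
        omega
    · rcases Nat.lt_or_ge k m with h | h
      · rw [Function.update_of_ne (by omega)]
        exact (hle k h).trans hij.le
      · obtain rfl : m = k := by omega
        rw [Function.update_self]
    · rcases Nat.lt_or_ge (k + 1) m with h | h
      · rw [Function.update_of_ne (by omega), Function.update_of_ne (by omega)]
        exact halt k h
      · obtain rfl : m = k + 1 := by omega
        rw [Function.update_of_ne (a := k) (by omega), Function.update_self]
        simp only [Nat.add_sub_cancel] at hl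
        rw [hl]
        exact ⟨fun he => hodd he.add_one, fun ho => heven (Nat.not_even_iff_odd.1 ho).add_one⟩

/-- The greedy count computes the length of the longest alternating subsequence. -/
lemma LA_eq_turns (a : ℕ → Λ) (n : ℕ) : LA (fun i : Fin (n + 1) => a i) = turns a n := by
  refine (isGreatest_LA _).unique ⟨?_, ?_⟩
  · obtain ⟨l, -, -, hmono, hle, halt⟩ := (altEnd_turns a n).exists_strictMono
    generalize turns a n = m at *
    refine ⟨fun k => ⟨l k, Nat.lt_succ_of_le (hle k k.2)⟩, ?_, fun k hk => halt k hk⟩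
    rcases m with _ | m
    · exact fun i => i.elim0
    · exact Fin.strictMono_iff_lt_succ.2 fun k => hmono k (by simp)
  · rintro m ⟨l, hl, halt⟩
    rcases Nat.eq_zero_or_pos m with rfl | hm
    · exact Nat.zero_le _
    have key : ∀ k (hk : k < m), AltEnd a (k + 1) (l ⟨k, hk⟩) := by
      intro k
      induction k with
      | zero => exact fun _ => .single _
      | succ k ih =>
        intro hk
        refine .snoc (ih (by omega)) (hl (by simp [Fin.lt_def])) (fun ho => ?_) (fun he => ?_)
        · exact (halt k hk).1 (by grind)
        · exact (halt k hk).2 (by grind)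
    have := ((key (m - 1) (by omega)).le_turns n (Nat.lt_succ_iff.1 (l _).2)).1
    omega

/-- The transitions of the chain of pairs (last letter, whether the last change was upwards). -/
def stepUp (x : Λ × Bool) (b : Λ) : Λ × Bool :=
  (b, decide (x.1 < b) || (x.2 && decide (x.1 = b)))

/-- Twice the number of local maxima that are completed by reading `b` in the state `x`. -/
noncomputable def peak (x : Λ × Bool) (b : Λ) : ℝ := if x.2 = true ∧ b < x.1 then 2 else 0

/-- The states visited from `x` while reading `a`. -/
def path {A S : Type*} (st : S → A → S) (x : S) (a : ℕ → A) : ℕ → S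
  | 0 => x
  | n + 1 => st (path st x a n) (a n)

/-- An odd count awaits a descent, hence means an up state; the initial flag `true` matches `turns a
0 = 1`. -/
lemma path_stepUp (a : ℕ → Λ) (n : ℕ) :
    path stepUp (a 0, true) (fun i => a (i + 1)) n = (a n, decide (Odd (turns a n))) := by
  induction n with
  | zero => simp [path, turns]
  | succ n ih =>
    rw [path, ih, turns, stepUp]
    simp only [Prod.mk.injEq, true_and]
    rcases Nat.even_or_odd (turns a n) with h | h
    · have h0 : ¬ Odd (turns a n) := Nat.not_odd_iff_even.2 h
      rcases lt_trichotomy (a n) (a (n + 1)) with h' | h' | h'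
      · simp [h, h0, h']
      · simp [h0, h']
      · simp [h0, h'.not_gt]
    · have h0 : ¬ Even (turns a n) := Nat.not_even_iff_odd.2 h
      rcases lt_trichotomy (a n) (a (n + 1)) with h' | h' | h'
      · simp [h, h0, h', h'.not_gt]
      · simp [h, h']
      · simp [h, h', h'.not_gt, h'.ne', Nat.odd_add_one]

/-- Turns alternate between descents and ascents. `peak` credits both at the descent, so one unit is
in advance exactly when the count is even. -/
lemma turns_eq (a : ℕ → Λ) (n : ℕ) :
    (turns a n : ℝ) = 1 - (if Even (turns a n) then 1 else 0) +
      ∑ i ∈ Finset.range n, peak (path stepUp (a 0, true) (fun i => a (i + 1)) i) (a (i + 1)) := by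
  induction n with
  | zero => simp [turns]
  | succ n ih =>
    have e : (∑ i ∈ Finset.range n,
        peak (path stepUp (a 0, true) (fun i => a (i + 1)) i) (a (i + 1))) =
        turns a n - 1 + (if Even (turns a n) then 1 else 0) := by linarith
    rw [Finset.sum_range_succ, e, path_stepUp, turns, peak]
    rcases Nat.even_or_odd (turns a n) with h | h
    · have h0 : ¬ Odd (turns a n) := Nat.not_odd_iff_even.2 h
      by_cases h' : a n < a (n + 1)
      · have : ¬ Even (turns a n + 1) := by simpa [Nat.even_add_one] using h
        simp [h, h0, h', this]
        ring
      · simp [h, h0, h']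
    · have h0 : ¬ Even (turns a n) := Nat.not_even_iff_odd.2 h
      by_cases h' : a (n + 1) < a n
      · have : Even (turns a n + 1) := h.add_one
        simp [h, h0, h', this]
        ring
      · simp [h, h0, h']

/-- The sum of the increments `F` along the path from `x` that reads the word `w`. -/
def pathSum {A S : Type*} (st : S → A → S) (F : S → A → ℝ) : (n : ℕ) → S → (Fin n → A) → ℝ
  | 0, _, _ => 0
  | n + 1, x, w => F x (w 0) + pathSum st F n (st x (w 0)) (Fin.tail w)

lemma path_succ {A S : Type*} (st : S → A → S) (x : S) (a : ℕ → A) (n : ℕ) :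
    path st x a (n + 1) = path st (st x (a 0)) (fun i => a (i + 1)) n := by
  induction n with
  | zero => rfl
  | succ n ih => rw [path, ih, path]

lemma pathSum_eq {A S : Type*} (st : S → A → S) (F : S → A → ℝ) (n : ℕ) (x : S) (a : ℕ → A) :
    pathSum st F n x (fun i => a i) = ∑ i ∈ Finset.range n, F (path st x a i) (a i) := by
  induction n generalizing x a with
  | zero => rfl
  | succ n ih =>
    rw [Finset.sum_range_succ', pathSum]
    have : Fin.tail (fun i : Fin (n + 1) => a i) = fun i : Fin n => a (i + 1) := by
      ext i; simp [Fin.tail]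
    rw [this, Fin.val_zero, ih (st x (a 0)) (fun i => a (i + 1)), add_comm]
    simp only [path_succ]
    rfl

lemma abs_LA_sub_pathSum_le {n : ℕ} (w : Fin (n + 1) → Λ) :
    |(LA w : ℝ) - pathSum stepUp peak n (w 0, true) (Fin.tail w)| ≤ 1 := by
  -- Periodic extension of the word; only the indices up to n matter.
  set a : ℕ → Λ := fun i => w (Fin.ofNat (n + 1) i) with ha
  have hw : w = fun i : Fin (n + 1) => a i := by ext i; simp [ha]
  have ht : Fin.tail w = fun i : Fin n => (fun i : ℕ => a (i + 1)) i := by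
    ext i
    simp only [Fin.tail, ha]
    congr 1
    ext
    simp [Nat.mod_eq_of_lt]
  have h0 : w 0 = a 0 := by simp [ha]
  rw [ht, pathSum_eq _ _ _ _ fun i => a (i + 1), h0, hw, LA_eq_turns, turns_eq a n]
  split_ifs <;> simp

end Turns

/-- Conditioning on the first letter turns the characteristic function of the path sum into an
iterate of the twisted operator. -/
lemma sum_prod_mul_exp_pathSum {A S : Type*} [Fintype A] (p : A → ℝ) (st : S → A → S)
    (F : S → A → ℝ) (t : ℝ) (n : ℕ) (x : S) :
    ∑ w : Fin n → A, ((∏ i, p (w i) : ℝ) : ℂ) * Complex.exp (Complex.I * t * pathSum st F n x w) =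
      (twisted p st F t)^[n] 1 x := by
  induction n generalizing x with
  | zero => simp [pathSum]
  | succ n ih =>
    rw [← (Fin.consEquiv fun _ => A).sum_comp, Fintype.sum_prod_type, Function.iterate_succ_apply',
      twisted]
    refine Finset.sum_congr rfl fun a _ => ?_
    rw [← ih, Finset.mul_sum]
    refine Finset.sum_congr rfl fun w _ => ?_
    have htail : Fin.tail ((Fin.consEquiv fun _ => A) (a, w)) = w := rfl
    simp only [htail, Fin.consEquiv_apply, Fin.prod_univ_succ, Fin.cons_zero, Fin.cons_succ, pathSum,
      Complex.ofReal_add, Complex.ofReal_mul, mul_add, Complex.exp_add]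
    ring

/-! ### Stationary mean and variance of the increments -/

section Stationary

variable {q : ℕ} {μ : Measure (Fin q)}

/-- The mass function of `μ`. -/
noncomputable def weight (μ : Measure (Fin q)) (x : Fin q) : ℝ := μ.real {x}


lemma weight_nonneg (x : Fin q) : 0 ≤ weight μ x := measureReal_nonneg

lemma lowerMass_nonneg (x : Fin q) : 0 ≤ lowerMass μ x :=
  Finset.sum_nonneg fun _ _ => measureReal_nonneg

lemma upperMass_nonneg (x : Fin q) : 0 ≤ upperMass μ x :=
  Finset.sum_nonneg fun _ _ => measureReal_nonneg

lemma oscAt_nonneg (x : Fin q) : 0 ≤ oscAt μ x := by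
  have := lowerMass_nonneg (μ := μ) x
  have := upperMass_nonneg (μ := μ) x
  unfold oscAt
  positivity

/-- Both sides are the sum of the products of weights over pairs y < x. -/
lemma sum_weight_mul_lowerMass :
    ∑ x, weight μ x * lowerMass μ x = ∑ x, weight μ x * upperMass μ x := by
  simp only [lowerMass, upperMass, Finset.mul_sum]
  rw [Finset.sum_comm' (t' := Finset.univ) (s' := fun y => Finset.Ioi y) (by simp)]
  simp only [weight, mul_comm]

variable {π : Fin q × Bool → ℝ}

/-- After one step the first coordinate is the letter just read, whose law is μ. -/
lemma IsStationary.marginal (hπ : IsStationary (weight μ) stepUp π) (c : Fin q) :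
    π (c, true) + π (c, false) = weight μ c := by
  have h := hπ.sum_avg fun x => if x.1 = c then 1 else 0
  have e1 : ∀ x, avg (weight μ) stepUp (fun x : Fin q × Bool => if x.1 = c then 1 else 0) x =
      weight μ c := fun x => by
    change ∑ a, weight μ a * (if a = c then 1 else 0) = _
    simp
  simp only [e1, ← Finset.sum_mul, hπ.sum_eq_one, one_mul] at h
  rw [h, Fintype.sum_prod_type]
  simp

variable [IsProbabilityMeasure μ]

lemma sum_weight : ∑ x, weight μ x = 1 := by
  simp [weight]

lemma weight_lt_one (hμ : ∀ x, μ {x} ≠ 1) (x : Fin q) : weight μ x < 1 := by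
  refine measureReal_le_one.lt_of_ne fun h => hμ x ?_
  have := ENNReal.ofReal_toReal (measure_ne_top μ {x})
  rw [← this]
  simp only [measureReal_def] at h
  simp [h]

lemma exists_weight_pos : ∃ x, 0 < weight μ x := by
  by_contra! h
  have := Finset.sum_nonpos fun x (_ : x ∈ Finset.univ) => h x
  rw [sum_weight] at this
  linarith

lemma lowerMass_add_upperMass (x : Fin q) : lowerMass μ x + upperMass μ x = 1 - weight μ x := by
  rw [eq_sub_iff_add_eq, ← sum_weight (μ := μ), lowerMass, upperMass, weight]
  have h1 : (Finset.univ : Finset (Fin q)) = (Finset.Iio x ∪ Finset.Ioi x) ∪ {x} := by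
    ext y
    rcases lt_trichotomy y x with h | h | h <;> simp [h, h.le]
  rw [h1, Finset.sum_union, Finset.sum_union]
  · simp [weight]
  · exact Finset.disjoint_left.2 fun y h h' => by simp at h h'; exact lt_asymm h h'
  · simp

/-- Since μ is not a point mass, two letters v < u have positive weight; reading u and then v leads
to (v, `false`) from anywhere. -/
lemma isSynchronizing_stepUp (hμ : ∀ x, μ {x} ≠ 1) :
    IsSynchronizing (weight μ) (stepUp (Λ := Fin q)) := by
  refine ⟨weight_nonneg, sum_weight, ?_⟩
  obtain ⟨x, hx⟩ := exists_weight_pos (μ := μ)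
  obtain ⟨y, hyx, hy⟩ : ∃ y, y ≠ x ∧ 0 < weight μ y := by
    by_contra! h
    have : ∑ y, weight μ y = weight μ x :=
      Finset.sum_eq_single x (fun y _ hy => le_antisymm (h y hy) (weight_nonneg y)) (by simp)
    rw [sum_weight] at this
    exact (weight_lt_one hμ x).ne this.symm
  have key : ∀ {u v : Fin q}, v < u → ∀ x y, stepUp (stepUp x u) v = stepUp (stepUp y u) v :=
    fun h x y => by simp [stepUp, h.not_gt, h.ne']
  rcases hyx.lt_or_gt with h | h
  · exact ⟨x, y, hx, hy, key h⟩
  · exact ⟨y, x, hy, hx, key h⟩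

lemma Osc_pos (hμ : ∀ x, μ {x} ≠ 1) : 0 < Osc μ := by
  obtain ⟨x, hx⟩ := exists_weight_pos (μ := μ)
  refine lt_of_lt_of_le ?_ (Finset.single_le_sum (f := fun x => oscAt μ x * μ.real {x})
    (fun y _ => mul_nonneg (oscAt_nonneg y) measureReal_nonneg) (Finset.mem_univ x))
  refine mul_pos ?_ hx
  have h0 : 0 < lowerMass μ x + upperMass μ x := by
    rw [lowerMass_add_upperMass]; linarith [weight_lt_one hμ x]
  refine div_pos ?_ h0
  nlinarith [sq_nonneg (lowerMass μ x - upperMass μ x), mul_pos h0 h0]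

/-- The state (c, `true`) is entered by reading c after a smaller letter or in (c, `true`) itself,
so its mass solves π = p_c (L_c + π); and 1 - p_c = L_c + U_c. -/
lemma IsStationary.up (hπ : IsStationary (weight μ) stepUp π) (c : Fin q) :
    π (c, true) * (lowerMass μ c + upperMass μ c) = weight μ c * lowerMass μ c := by
  have h := hπ.sum_avg fun x => if x = (c, true) then 1 else 0
  have e1 : ∀ x : Fin q × Bool, avg (weight μ) stepUp (fun x => if x = (c, true) then 1 else 0) x =
      weight μ c * ((if x.1 < c then 1 else 0) + if x = (c, true) then 1 else 0) := by
    rintro ⟨y, f⟩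
    rw [avg, Finset.sum_eq_single c]
    · rcases lt_trichotomy y c with h | h | h
      · simp [stepUp, h, h.ne]
      · subst h; cases f <;> simp [stepUp]
      · simp [stepUp, h.not_gt, h.ne']
    · intro b _ hb; simp [stepUp, hb]
    · simp
  simp only [e1, mul_ite, mul_one, mul_zero, Finset.sum_ite_eq', Finset.mem_univ, if_true] at h
  have e2 : ∑ x, π x * (weight μ c * ((if x.1 < c then 1 else 0) +
      if x = (c, true) then 1 else 0)) = weight μ c * (lowerMass μ c + π (c, true)) := by
    simp only [mul_add, Finset.sum_add_distrib]
    congr 1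
    · rw [Fintype.sum_prod_type, lowerMass, Finset.mul_sum]
      rw [← Finset.sum_subset (Finset.subset_univ (Finset.Iio c))]
      · refine Finset.sum_congr rfl fun y hy => ?_
        rw [Fintype.sum_bool, if_pos (by simpa using hy)]
        have := hπ.marginal y
        rw [weight] at this
        rw [← this]
        ring
      · intro y _ hy
        rw [Finset.mem_Iio] at hy
        simp [hy]
    · simp
      ring
  simp only [mul_add, mul_ite, mul_one, mul_zero] at h e2
  rw [e2] at h
  rw [lowerMass_add_upperMass]
  linarith

/-- The mean increment in the stationary regime is the oscillation. -/
lemma IsStationary.sum_peak (hμ : ∀ x, μ {x} ≠ 1) (hπ : IsStationary (weight μ) stepUp π) :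
    ∑ x, π x * ∑ b, weight μ b * peak x b = Osc μ := by
  have e1 : ∀ c : Fin q, ∑ b, weight μ b * peak (c, true) b = 2 * lowerMass μ c := by
    intro c
    rw [lowerMass, Finset.mul_sum, ← Finset.sum_subset (Finset.subset_univ (Finset.Iio c))]
    · refine Finset.sum_congr rfl fun b hb => ?_
      rw [Finset.mem_Iio] at hb
      simp [peak, hb, weight, mul_comm]
    · intro b _ hb
      rw [Finset.mem_Iio] at hb
      simp [peak, hb]
  have e2 : ∀ c : Fin q, ∑ b, weight μ b * peak (c, false) b = 0 := fun c => by simp [peak]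
  -- From 2L²/(L+U) = (L²+U²)/(L+U) + (L-U); the antisymmetric part cancels after summation over c.
  have e3 : ∀ c, π (c, true) * (2 * lowerMass μ c) =
      oscAt μ c * μ.real {c} + (weight μ c * lowerMass μ c - weight μ c * upperMass μ c) := by
    intro c
    have h0 : lowerMass μ c + upperMass μ c ≠ 0 := by
      rw [lowerMass_add_upperMass]; linarith [weight_lt_one hμ c]
    have h1 : π (c, true) = weight μ c * lowerMass μ c / (lowerMass μ c + upperMass μ c) := by
      rw [eq_div_iff h0, hπ.up]
    rw [h1, oscAt, ← weight]
    field_simp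
    ring
  simp only [Fintype.sum_prod_type, Fintype.sum_bool, e1, e2, e3, mul_zero, add_zero]
  rw [Finset.sum_add_distrib, Finset.sum_sub_distrib, sum_weight_mul_lowerMass, sub_self,
    add_zero, Osc]

/-- The centred increments. -/
noncomputable def centredPeak (μ : Measure (Fin q)) (x : Fin q × Bool) (b : Fin q) : ℝ :=
  peak x b - Osc μ

/-- The conditional mean of the centred increment. -/
noncomputable def drift (μ : Measure (Fin q)) (x : Fin q × Bool) : ℝ :=
  ∑ b, weight μ b * centredPeak μ x b

lemma IsStationary.sum_drift (hμ : ∀ x, μ {x} ≠ 1) (hπ : IsStationary (weight μ) stepUp π) :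
    ∑ x, π x * drift μ x = 0 := by
  have h := hπ.sum_peak hμ
  simp only [drift, centredPeak, mul_sub, Finset.sum_sub_distrib, ← Finset.sum_mul, sum_weight,
    one_mul, hπ.sum_eq_one, h, sub_self]

/-- The corrector of the increments. -/
noncomputable def corrector (μ : Measure (Fin q)) : Fin q × Bool → ℝ :=
  potential (weight μ) stepUp (drift μ)

lemma IsStationary.corrector_eq (hμ : ∀ x, μ {x} ≠ 1) (hπ : IsStationary (weight μ) stepUp π)
    (x : Fin q × Bool) :
    corrector μ x = ∑ b, weight μ b * (centredPeak μ x b + corrector μ (stepUp x b)) := by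
  rw [corrector, potential_eq (isSynchronizing_stepUp hμ) hπ (hπ.sum_drift hμ)]
  simp [drift, avg, mul_add, Finset.sum_add_distrib]

/-- The asymptotic variance is a second moment of martingale increments. -/
lemma IsStationary.variance_eq (hμ : ∀ x, μ {x} ≠ 1) (hπ : IsStationary (weight μ) stepUp π) :
    ∑ x, π x * ∑ b, weight μ b *
      (centredPeak μ x b ^ 2 + 2 * (centredPeak μ x b * corrector μ (stepUp x b))) =
    ∑ x, π x * ∑ b, weight μ b *
      (centredPeak μ x b + corrector μ (stepUp x b) - corrector μ x) ^ 2 := by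
  have h := hπ.sum_avg fun x => corrector μ x ^ 2
  rw [← sub_eq_zero, ← Finset.sum_sub_distrib] at h ⊢
  rw [← neg_eq_zero, ← Finset.sum_neg_distrib] at h
  rw [← h]
  refine Finset.sum_congr rfl fun x _ => ?_
  have e := hπ.corrector_eq hμ x
  -- Expand the square. By the Poisson equation the cross term is -2 `corrector`², and stationarity
  -- cancels the remaining squares of the corrector.
  have e' : ∑ b, weight μ b * (centredPeak μ x b + corrector μ (stepUp x b) - corrector μ x) ^ 2 =
      ∑ b, weight μ b *
        (centredPeak μ x b ^ 2 + 2 * (centredPeak μ x b * corrector μ (stepUp x b))) +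
      avg (weight μ) stepUp (fun x => corrector μ x ^ 2) x -
      2 * corrector μ x * ∑ b, weight μ b * (centredPeak μ x b + corrector μ (stepUp x b)) +
      (∑ b, weight μ b) * corrector μ x ^ 2 := by
    rw [avg, Finset.mul_sum, Finset.sum_mul, ← Finset.sum_add_distrib, ← Finset.sum_sub_distrib,
      ← Finset.sum_add_distrib]
    exact Finset.sum_congr rfl fun b _ => by ring
  rw [e', ← e, sum_weight]
  ring

/-- A loop suffices: at a state (c, f) of positive mass, reading c again leaves the corrector
unchanged, so that martingale increment is -`Osc μ`, which is nonzero. -/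
lemma IsStationary.variance_pos (hμ : ∀ x, μ {x} ≠ 1) (hπ : IsStationary (weight μ) stepUp π) :
    0 < ∑ x, π x * ∑ b, weight μ b *
      (centredPeak μ x b ^ 2 + 2 * (centredPeak μ x b * corrector μ (stepUp x b))) := by
  rw [hπ.variance_eq hμ]
  obtain ⟨c, hc⟩ := exists_weight_pos (μ := μ)
  have hm := hπ.marginal c
  obtain ⟨f, hf⟩ : ∃ f, 0 < π (c, f) := by
    by_contra! h
    linarith [h true, h false]
  have hb : ∀ x b, 0 ≤ weight μ b *
      (centredPeak μ x b + corrector μ (stepUp x b) - corrector μ x) ^ 2 :=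
    fun x b => mul_nonneg (weight_nonneg b) (sq_nonneg _)
  refine lt_of_lt_of_le ?_ (Finset.single_le_sum (fun x _ => mul_nonneg (hπ.nonneg x)
    (Finset.sum_nonneg fun b _ => hb x b)) (Finset.mem_univ (c, f)))
  refine mul_pos hf (lt_of_lt_of_le ?_
    (Finset.single_le_sum (fun b _ => hb (c, f) b) (Finset.mem_univ c)))
  refine mul_pos hc ?_
  have h1 : stepUp (c, f) c = (c, f) := by simp [stepUp]
  have h2 : centredPeak μ (c, f) c = - Osc μ := by simp [centredPeak, peak]
  rw [h1, h2]
  have := Osc_pos hμ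
  have h3 : -Osc μ + corrector μ (c, f) - corrector μ (c, f) = -Osc μ := by ring
  rw [h3]
  nlinarith

end Stationary

/-! ### The bilateral stationary chain and its covariances -/

section States

variable {q : ℕ}

/-- Some ascent of `a` precedes the block of equal letters that ends at `k`. -/
def HasAscentBefore (a : ℤ → Fin q) (k : ℤ) : Prop :=
  ∃ j < k, a j < a (j + 1) ∧ ∀ i, j + 1 ≤ i → i ≤ k → a i = a k

open Classical in
/-- The state of the chain of `stepUp` after reading the bilateral sequence `a` up to `k`. -/
noncomputable def stateAt (k : ℤ) (a : ℤ → Fin q) : Fin q × Bool :=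
  (a k, decide (HasAscentBefore a k))

lemma hasAscentBefore_succ (a : ℤ → Fin q) (k : ℤ) :
    HasAscentBefore a (k + 1) ↔ a k < a (k + 1) ∨ (HasAscentBefore a k ∧ a k = a (k + 1)) := by
  constructor
  · rintro ⟨j, hj, hlt, h⟩
    rcases (Int.lt_add_one_iff.1 hj).eq_or_lt with rfl | hjk
    · exact .inl hlt
    · have hk := h k (by lia) (by lia)
      exact .inr ⟨⟨j, hjk, hlt, fun i h1 h2 => (h i h1 (by lia)).trans hk.symm⟩, hk⟩
  · rintro (hlt | ⟨⟨j, hj, hlt, h⟩, hk⟩)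
    · exact ⟨k, by lia, hlt, fun i h1 h2 => by rw [le_antisymm h2 h1]⟩
    · refine ⟨j, by lia, hlt, fun i h1 h2 => ?_⟩
      rcases h2.eq_or_lt with rfl | h2
      · rfl
      · exact (h i h1 (by lia)).trans hk

lemma stateAt_succ (k : ℤ) (a : ℤ → Fin q) :
    stateAt (k + 1) a = stepUp (stateAt k a) (a (k + 1)) := by
  classical
  refine Prod.ext rfl ?_
  change decide (HasAscentBefore a (k + 1)) =
    (decide (a k < a (k + 1)) || (decide (HasAscentBefore a k) && decide (a k = a (k + 1))))
  rw [Bool.eq_iff_iff]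
  simp [hasAscentBefore_succ]

lemma iterate_shift (k : ℕ) (a : ℤ → Fin q) : shift^[k] a = fun i => a (i + k) := by
  induction k with
  | zero => simp
  | succ k ih =>
    rw [Function.iterate_succ_apply', ih]
    ext i
    simp [shift, add_assoc, add_comm (1 : ℤ)]

lemma stateAt_iterate_shift (k : ℕ) (a : ℤ → Fin q) :
    stateAt 0 (shift^[k] a) = stateAt k a := by
  have : HasAscentBefore (fun i => a (i + k)) 0 ↔ HasAscentBefore a k := by
    constructor
    · rintro ⟨j, hj, hlt, h⟩
      refine ⟨j + k, by lia, by rwa [add_right_comm], fun i h1 h2 => ?_⟩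
      simpa using h (i - k) (by lia) (by lia)
    · rintro ⟨j, hj, hlt, h⟩
      refine ⟨j - k, by lia, ?_, fun i h1 h2 => ?_⟩
      · simpa [sub_add_cancel, sub_add_eq_add_sub] using hlt
      · simpa using h (i + k) (by lia) (by lia)
  rw [iterate_shift]
  simp [stateAt, this]

lemma twiceLocalMax_eq (a : ℤ → Fin q) : twiceLocalMax a = peak (stateAt 0 a) (a 1) := by
  have : HasLocalMaxAt a 0 ↔ HasAscentBefore a 0 ∧ a 1 < a 0 := by
    simp only [HasLocalMaxAt, HasAscentBefore, zero_add]
    constructor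
    · rintro ⟨j, h1, h2, h3, h4⟩
      exact ⟨⟨j, h1, h2, h3⟩, h4⟩
    · rintro ⟨⟨j, h1, h2, h3⟩, h4⟩
      exact ⟨j, h1, h2, h3, h4⟩
  have h2 : (stateAt 0 a).2 = true ↔ HasAscentBefore a 0 := by simp [stateAt]
  have h3 : (stateAt 0 a).1 = a 0 := rfl
  classical
  rw [twiceLocalMax, Set.indicator_apply, peak]
  exact if_congr (by rw [Set.mem_ofPred_eq, this, h2, h3]) rfl rfl

lemma twiceLocalMax_iterate_shift (k : ℕ) (a : ℤ → Fin q) :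
    twiceLocalMax (shift^[k] a) = peak (stateAt k a) (a (k + 1)) := by
  rw [twiceLocalMax_eq, stateAt_iterate_shift, iterate_shift, add_comm (k : ℤ)]

/-- The σ-algebra generated by the letters up to the index `k`. -/
@[reducible] def past (q : ℕ) (k : ℤ) : MeasurableSpace (ℤ → Fin q) :=
  ⨆ i ∈ Set.Iic k, MeasurableSpace.comap (fun a => a i) inferInstance

lemma past_mono {k l : ℤ} (h : k ≤ l) : past q k ≤ past q l :=
  biSup_mono fun _ hi => le_trans (Set.mem_Iic.1 hi) h

lemma measurable_past_eval {i k : ℤ} (h : i ≤ k) : Measurable[past q k] fun a : ℤ → Fin q => a i :=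
  (comap_measurable _).mono (le_biSup (fun i => MeasurableSpace.comap
    (fun a : ℤ → Fin q => a i) inferInstance) (Set.mem_Iic.2 h)) le_rfl

lemma past_le (k : ℤ) : past q k ≤ MeasurableSpace.pi :=
  iSup₂_le fun i _ => (measurable_pi_apply i).comap_le

lemma measurable_past_stateAt (k : ℤ) :
    Measurable[past q k] (stateAt k : (ℤ → Fin q) → Fin q × Bool) := by
  classical
  let _ : MeasurableSpace (ℤ → Fin q) := past q k
  have he : ∀ i ≤ k, Measurable fun a : ℤ → Fin q => a i := fun i hi => measurable_past_eval hi
  refine (he k le_rfl).prodMk (measurable_to_bool ?_)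
  have : (fun a : ℤ → Fin q => decide (HasAscentBefore a k)) ⁻¹' {true} =
      ⋃ j ∈ Set.Iio k, ({a | a j < a (j + 1)} ∩ ⋂ i ∈ Set.Icc (j + 1) k, {a | a i = a k}) := by
    ext a
    rw [Set.mem_preimage, Set.mem_singleton_iff, decide_eq_true_eq, HasAscentBefore]
    simp only [Set.mem_iUnion, Set.mem_inter_iff, Set.mem_iInter, Set.mem_ofPred_eq, Set.mem_Iio,
      Set.mem_Icc, exists_prop, and_imp]
  rw [this]
  refine .biUnion (Set.to_countable _) fun j hj => .inter ?_ (.biInter (Set.to_countable _)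
    fun i hi => ?_)
  · exact measurableSet_lt (he j (Set.mem_Iio.1 hj).le) (he (j + 1) (Set.mem_Iio.1 hj))
  · exact measurableSet_eq_fun (he i hi.2) (he k le_rfl)

variable {μ : Measure (Fin q)} [IsProbabilityMeasure μ]

instance : IsProbabilityMeasure (bilateralLaw μ) := by
  unfold bilateralLaw; infer_instance

lemma integrable_comp_of_finite {Ω β : Type*} [MeasurableSpace Ω] {P : Measure Ω}
    [IsFiniteMeasure P] [Finite β] [MeasurableSpace β] [MeasurableSingletonClass β] {V : Ω → β}
    (hV : Measurable V) (g : β → ℝ) : Integrable (fun ω => g (V ω)) P :=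
  (Integrable.of_finite (f := g) (μ := P.map V)).comp_measurable hV

lemma integral_eval (k : ℤ) (g : Fin q → ℝ) :
    ∫ a, g (a k) ∂bilateralLaw μ = ∑ b, weight μ b * g b := by
  have h := measurePreserving_eval_infinitePi (fun _ : ℤ => μ) k
  rw [← integral_map (φ := fun a : ℤ → Fin q => a k) (f := g) (measurable_pi_apply k).aemeasurable
    (measurable_of_finite g).aestronglyMeasurable]
  have : (bilateralLaw μ).map (fun a : ℤ → Fin q => a k) = μ := h.map_eq
  rw [this, integral_fintype .of_finite]
  rfl

/-- A letter may be integrated out against anything determined by the preceding letters. -/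
lemma integral_past {β : Type*} [Finite β] [MeasurableSpace β] [MeasurableSingletonClass β]
    {k : ℤ} {V : (ℤ → Fin q) → β} (hV : Measurable[past q k] V) (G : β → Fin q → ℝ) :
    ∫ a, G (V a) (a (k + 1)) ∂bilateralLaw μ =
      ∫ a, ∑ b, weight μ b * G (V a) b ∂bilateralLaw μ := by
  have hV' : Measurable V := hV.mono (past_le k) le_rfl
  have hind : IndepFun V (fun a : ℤ → Fin q => a (k + 1)) (bilateralLaw μ) := by
    have hi : iIndepFun (fun (i : ℤ) (a : ℤ → Fin q) => a i) (bilateralLaw μ) :=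
      iIndepFun_infinitePi (X := fun _ b => b) fun _ => measurable_id
    have h := indep_iSup_of_disjoint (fun i => (measurable_pi_apply i).comap_le) hi
      (S := Set.Iic k) (T := {k + 1}) (by simp)
    rw [IndepFun_iff_Indep]
    refine indep_of_indep_of_le_left (indep_of_indep_of_le_right h ?_) hV.comap_le
    exact le_biSup (fun i => MeasurableSpace.comap (fun a : ℤ → Fin q => a i) inferInstance)
      (Set.mem_singleton (k + 1))
  -- Splitting over the values of the new letter reduces the claim to expectations of products of
  -- independent factors.
  have e1 : ∀ a : ℤ → Fin q, G (V a) (a (k + 1)) =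
      ∑ b, G (V a) b * (if a (k + 1) = b then 1 else 0) := fun a => by simp
  simp only [e1]
  have hint : ∀ b, Integrable (fun a : ℤ → Fin q => G (V a) b * (if a (k + 1) = b then 1 else 0))
      (bilateralLaw μ) := fun b =>
    integrable_comp_of_finite (hV'.prodMk (measurable_pi_apply (k + 1)))
      (fun x : β × Fin q => G x.1 b * (if x.2 = b then 1 else 0))
  rw [integral_finsetSum _ fun b _ => hint b,
    integral_finsetSum _ fun b _ => (integrable_comp_of_finite hV' (fun x => G x b)).const_mul _]
  refine Finset.sum_congr rfl fun b _ => ?_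
  have h2 : IndepFun (fun a => G (V a) b)
      (fun a : ℤ → Fin q => if a (k + 1) = b then (1 : ℝ) else 0) (bilateralLaw μ) :=
    hind.comp (measurable_of_finite fun x => G x b)
      (measurable_of_finite fun c => if c = b then (1 : ℝ) else 0)
  rw [h2.integral_fun_mul_eq_mul_integral
    (integrable_comp_of_finite hV' (fun x => G x b)).aestronglyMeasurable
    (integrable_comp_of_finite (V := fun a : ℤ → Fin q => a (k + 1)) (measurable_pi_apply _)
      (fun c : Fin q => if c = b then (1 : ℝ) else 0)).aestronglyMeasurable,
    integral_eval (k + 1) fun c => if c = b then (1 : ℝ) else 0, integral_const_mul, mul_comm]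
  simp

/-- The stationary law of the states. -/
noncomputable def stateLaw (μ : Measure (Fin q)) [IsProbabilityMeasure μ] (x : Fin q × Bool) : ℝ :=
  ((bilateralLaw μ).map (stateAt 0)).real {x}

lemma measurable_stateAt (k : ℤ) : Measurable (stateAt k : (ℤ → Fin q) → Fin q × Bool) :=
  (measurable_past_stateAt k).mono (past_le k) le_rfl

lemma integral_stateAt_zero (h : Fin q × Bool → ℝ) :
    ∫ a, h (stateAt 0 a) ∂bilateralLaw μ = ∑ x, stateLaw μ x * h x := by
  rw [← integral_map (φ := stateAt 0) (f := h) (measurable_stateAt 0).aemeasurable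
    (measurable_of_finite h).aestronglyMeasurable, integral_fintype .of_finite]
  rfl

lemma measurePreserving_shift :
    MeasurePreserving (shift (q := q)) (bilateralLaw μ) (bilateralLaw μ) := by
  -- The shift relabels coordinates by i ↦ i - 1, and all factors of the product are equal.
  have h := Measure.infinitePi_map_piCongrLeft (fun _ : ℤ => μ) (Equiv.subRight (1 : ℤ))
  have e : ⇑(MeasurableEquiv.piCongrLeft (fun _ : ℤ => Fin q) (Equiv.subRight (1 : ℤ))) =
      shift := by
    ext a i
    have := Equiv.piCongrLeft_apply_apply (fun _ : ℤ => Fin q) (Equiv.subRight (1 : ℤ)) a (i + 1)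
    simp only [Equiv.subRight_apply, add_sub_cancel_right] at this
    rw [MeasurableEquiv.coe_piCongrLeft, this, shift]
  rw [e] at h
  exact ⟨measurable_pi_lambda _ fun i => measurable_pi_apply _, h⟩

lemma integral_stateAt_succ (k : ℤ) (h : Fin q × Bool → ℝ) :
    ∫ a, h (stateAt (k + 1) a) ∂bilateralLaw μ =
      ∫ a, avg (weight μ) stepUp h (stateAt k a) ∂bilateralLaw μ := by
  simp only [stateAt_succ]
  exact integral_past (measurable_past_stateAt k) fun x b => h (stepUp x b)

variable (μ) in
lemma isStationary_stateLaw : IsStationary (weight μ) stepUp (stateLaw μ) where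
  nonneg _ := measureReal_nonneg
  sum_eq_one := by
    simpa using (integral_stateAt_zero (μ := μ) fun _ => 1).symm
  sum_avg h := by
    rw [← integral_stateAt_zero (μ := μ) h, ← integral_stateAt_zero (μ := μ) (avg (weight μ) stepUp h),
      ← integral_stateAt_succ (μ := μ) 0 h]
    -- Stationarity of the chain is thus shift invariance of the bilateral law.
    have h1 : ∀ a : ℤ → Fin q, stateAt (0 + 1) a = stateAt 0 (shift a) := fun a =>
      (stateAt_iterate_shift 1 a).symm
    simp only [h1]
    have hT := measurePreserving_shift (μ := μ)
    have h2 := integral_map (μ := bilateralLaw μ) (φ := shift) (f := fun a => h (stateAt 0 a))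
      hT.measurable.aemeasurable
      ((measurable_of_finite h).comp (measurable_stateAt 0)).aestronglyMeasurable
    rw [hT.map_eq] at h2
    exact h2.symm

lemma integral_stateAt (k : ℕ) (h : Fin q × Bool → ℝ) :
    ∫ a, h (stateAt k a) ∂bilateralLaw μ = ∑ x, stateLaw μ x * h x := by
  induction k generalizing h with
  | zero => exact integral_stateAt_zero h
  | succ k ih =>
    rw [Nat.cast_succ, integral_stateAt_succ, ih, (isStationary_stateLaw μ).sum_avg]

lemma integral_twiceLocalMax (hμ : ∀ x, μ {x} ≠ 1) (k : ℕ) :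
    ∫ a, twiceLocalMax (shift^[k] a) ∂bilateralLaw μ = Osc μ := by
  simp only [twiceLocalMax_iterate_shift]
  rw [integral_past (measurable_past_stateAt k) peak,
    integral_stateAt k fun x => ∑ b, weight μ b * peak x b,
    (isStationary_stateLaw μ).sum_peak hμ]

lemma lagCov_eq_integral (hμ : ∀ x, μ {x} ≠ 1) (k : ℕ) :
    lagCov μ k = ∫ a, centredPeak μ (stateAt 0 a) (a (0 + 1)) *
      centredPeak μ (stateAt k a) (a (k + 1)) ∂bilateralLaw μ := by
  have h0 : ∫ a, twiceLocalMax a ∂bilateralLaw μ = Osc μ := integral_twiceLocalMax hμ 0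
  have hk := integral_twiceLocalMax hμ k
  simp only [lagCov, covariance, Function.comp_apply, h0, hk]
  simp only [twiceLocalMax_iterate_shift]
  simp only [twiceLocalMax_eq, centredPeak, zero_add]

lemma lagCov_zero (hμ : ∀ x, μ {x} ≠ 1) :
    lagCov μ 0 = ∑ x, stateLaw μ x * ∑ b, weight μ b * centredPeak μ x b ^ 2 := by
  rw [lagCov_eq_integral hμ]
  simp only [Nat.cast_zero, ← sq]
  rw [integral_past (measurable_past_stateAt 0) fun x b => centredPeak μ x b ^ 2,
    integral_stateAt_zero fun x => ∑ b, weight μ b * centredPeak μ x b ^ 2]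

/-- Integrate out the letters from the latest backwards; each costs one application of the
transition operator to h. -/
lemma integral_mul_stateAt (G : Fin q × Bool → Fin q → ℝ) (k : ℕ) (h : Fin q × Bool → ℝ) :
    ∫ a, G (stateAt 0 a) (a (0 + 1)) * h (stateAt (k + 1) a) ∂bilateralLaw μ =
      ∑ x, stateLaw μ x * ∑ b, weight μ b *
        (G x b * (avg (weight μ) stepUp)^[k] h (stepUp x b)) := by
  induction k generalizing h with
  | zero =>
    simp only [Nat.cast_zero, stateAt_succ 0]
    rw [integral_past (measurable_past_stateAt 0) fun x b => G x b * h (stepUp x b),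
      integral_stateAt_zero fun x => ∑ b, weight μ b * (G x b * h (stepUp x b))]
    rfl
  | succ k ih =>
    have hV : Measurable[past q (k + 1)] fun a : ℤ → Fin q =>
        ((stateAt 0 a, a (0 + 1)), stateAt (k + 1) a) :=
      (((measurable_past_stateAt 0).mono (past_mono (by positivity)) le_rfl).prodMk
        (measurable_past_eval (by simp))).prodMk (measurable_past_stateAt (k + 1))
    rw [Function.iterate_succ_apply, ← ih]
    simp only [Nat.cast_succ, stateAt_succ ((k : ℤ) + 1)]
    rw [integral_past hV fun x b => G x.1.1 x.1.2 * h (stepUp x.2 b)]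
    simp only [avg, Finset.mul_sum, mul_left_comm]

lemma lagCov_succ (hμ : ∀ x, μ {x} ≠ 1) (k : ℕ) :
    lagCov μ (k + 1) = ∑ x, stateLaw μ x * ∑ b, weight μ b *
      (centredPeak μ x b * (avg (weight μ) stepUp)^[k] (drift μ) (stepUp x b)) := by
  have hV : Measurable[past q (k + 1)] fun a : ℤ → Fin q =>
      ((stateAt 0 a, a (0 + 1)), stateAt (k + 1) a) :=
    (((measurable_past_stateAt 0).mono (past_mono (by positivity)) le_rfl).prodMk
      (measurable_past_eval (by simp))).prodMk (measurable_past_stateAt (k + 1))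
  rw [lagCov_eq_integral hμ, ← integral_mul_stateAt, Nat.cast_succ,
    integral_past hV fun x b => centredPeak μ x.1.1 x.1.2 * centredPeak μ x.2 b]
  simp only [drift, Finset.mul_sum, mul_left_comm]

lemma hasSum_lagCov_succ (hμ : ∀ x, μ {x} ≠ 1) :
    HasSum (fun k => lagCov μ (k + 1)) (∑ x, stateLaw μ x * ∑ b, weight μ b *
      (centredPeak μ x b * corrector μ (stepUp x b))) := by
  have hπ := isStationary_stateLaw μ
  simp only [lagCov_succ hμ]
  exact hasSum_sum fun x _ => (hasSum_sum fun b _ => ((hasSum_potential (isSynchronizing_stepUp hμ)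
    hπ (hπ.sum_drift hμ) _).mul_left _).mul_left _).mul_left _

lemma gammaSq_eq (hμ : ∀ x, μ {x} ≠ 1) :
    gammaSq μ = ∑ x, stateLaw μ x * ∑ b, weight μ b *
      (centredPeak μ x b ^ 2 + 2 * (centredPeak μ x b * corrector μ (stepUp x b))) := by
  rw [gammaSq, (hasSum_lagCov_succ hμ).tsum_eq, lagCov_zero hμ, Finset.mul_sum,
    ← Finset.sum_add_distrib]
  refine Finset.sum_congr rfl fun x _ => ?_
  rw [mul_left_comm, ← mul_add, Finset.mul_sum, ← Finset.sum_add_distrib]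
  exact congrArg _ (Finset.sum_congr rfl fun b _ => by ring)

lemma gammaSq_pos (hμ : ∀ x, μ {x} ≠ 1) : 0 < gammaSq μ := by
  rw [gammaSq_eq hμ]
  exact (isStationary_stateLaw μ).variance_pos hμ

end States

/-! ### Convergence of characteristic functions -/

section Limit

variable {q : ℕ}

lemma pathSum_centredPeak (μ : Measure (Fin q)) (n : ℕ) (x : Fin q × Bool) (w : Fin n → Fin q) :
    pathSum stepUp (centredPeak μ) n x w = pathSum stepUp peak n x w - n * Osc μ := by
  induction n generalizing x with
  | zero => simp [pathSum]
  | succ n ih =>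
    rw [pathSum, pathSum, ih, centredPeak]
    push_cast
    ring

lemma norm_exp_I_mul_sub_exp_I_mul_le (t y z : ℝ) :
    ‖Complex.exp (Complex.I * t * y) - Complex.exp (Complex.I * t * z)‖ ≤ |t| * |y - z| := by
  have e : Complex.exp (Complex.I * t * y) - Complex.exp (Complex.I * t * z) =
      Complex.exp (Complex.I * t * z) * (Complex.exp (Complex.I * (t * (y - z) : ℝ)) - 1) := by
    rw [mul_sub, ← Complex.exp_add, mul_one]
    congr 2
    push_cast
    ring
  have h1 : ‖Complex.exp (Complex.I * t * z)‖ = 1 := by rw [Complex.norm_exp]; simp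
  rw [e, norm_mul, h1, one_mul, ← abs_mul]
  exact Real.norm_exp_I_mul_ofReal_sub_one_le

variable {μ : Measure (Fin q)} [IsProbabilityMeasure μ]

lemma sum_prod_weight (n : ℕ) : ∑ w : Fin n → Fin q, ∏ i, weight μ (w i) = 1 := by
  rw [← Fintype.piFinset_univ, ← Finset.prod_univ_sum]
  simp [sum_weight]

/-- The characteristic function of the centred length is nearly Gaussian. -/
lemma exists_norm_sum_exp_sub_le (hμ : ∀ x, μ {x} ≠ 1) :
    ∃ C : ℝ, 0 ≤ C ∧ ∀ t : ℝ, |t| ≤ 1 → ∀ n : ℕ,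
      ‖∑ w : Fin (n + 1) → Fin q, ((∏ i, weight μ (w i) : ℝ) : ℂ) *
          Complex.exp (Complex.I * t * ((LA w : ℝ) - (n + 1 : ℕ) * Osc μ : ℝ)) -
        Complex.exp (-(t ^ 2 * gammaSq μ / 2)) ^ n‖ ≤ C * (|t| + n * |t| ^ 3) := by
  have hπ := isStationary_stateLaw μ
  have hs := isSynchronizing_stepUp hμ
  -- The second-order condition reads k = k₀ + `avg` k. It is solvable by a potential because k₀ has
  -- stationary mean zero, which is the formula for `gammaSq μ`.
  set k₀ : Fin q × Bool → ℝ := fun x => gammaSq μ / 2 -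
    ∑ b, weight μ b * (centredPeak μ x b * corrector μ (stepUp x b) + centredPeak μ x b ^ 2 / 2)
    with hk₀
  have hk₀π : ∑ x, stateLaw μ x * k₀ x = 0 := by
    simp only [hk₀, mul_sub, Finset.sum_sub_distrib, ← Finset.sum_mul, hπ.sum_eq_one, one_mul]
    rw [gammaSq_eq hμ, Finset.sum_div, sub_eq_zero]
    refine Finset.sum_congr rfl fun x _ => ?_
    rw [mul_div_assoc, Finset.sum_div]
    exact congrArg _ (Finset.sum_congr rfl fun b _ => by ring)
  obtain ⟨C, hC0, hC⟩ := exists_norm_iterate_twisted_sub_le hs (centredPeak μ) (corrector μ)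
    (potential (weight μ) stepUp k₀) (gammaSq_pos hμ).le (hπ.corrector_eq hμ) (fun x => by
      rw [potential_eq hs hπ hk₀π, hk₀, avg]
      simp only [mul_sub, mul_add, Finset.sum_sub_distrib, Finset.sum_add_distrib]
      ring)
  -- 1 bounds the gap between `LA` and the path sum, `Osc μ` pays for centring n + 1 letters with
  -- only n transitions, and C is the spectral error.
  refine ⟨1 + Osc μ + C, by linarith [Osc_pos hμ], fun t ht n => ?_⟩
  set E := Complex.exp (-(t ^ 2 * gammaSq μ / 2)) ^ n
  set c : (Fin (n + 1) → Fin q) → ℝ := fun w =>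
    pathSum stepUp (centredPeak μ) n (w 0, true) (Fin.tail w) with hc
  have h1 : ‖∑ w : Fin (n + 1) → Fin q, ((∏ i, weight μ (w i) : ℝ) : ℂ) *
        Complex.exp (Complex.I * t * ((LA w : ℝ) - (n + 1 : ℕ) * Osc μ : ℝ)) -
      ∑ w : Fin (n + 1) → Fin q, ((∏ i, weight μ (w i) : ℝ) : ℂ) *
        Complex.exp (Complex.I * t * c w)‖ ≤ (1 + Osc μ) * |t| := by
    rw [← Finset.sum_sub_distrib]
    refine (norm_sum_le_of_le _ fun w _ => ?_).trans_eq
      (show ∑ w : Fin (n + 1) → Fin q, (∏ i, weight μ (w i)) * ((1 + Osc μ) * |t|) = _ by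
        rw [← Finset.sum_mul, sum_prod_weight, one_mul])
    have hw : 0 ≤ ∏ i, weight μ (w i) := Finset.prod_nonneg fun i _ => weight_nonneg _
    rw [← mul_sub, norm_mul, Complex.norm_real, Real.norm_of_nonneg hw]
    refine mul_le_mul_of_nonneg_left
      ((norm_exp_I_mul_sub_exp_I_mul_le _ _ _).trans ?_) hw
    rw [mul_comm]
    refine mul_le_mul_of_nonneg_right ?_ (abs_nonneg t)
    rw [hc]
    simp only [pathSum_centredPeak]
    have h2 := abs_le.1 (abs_LA_sub_pathSum_le w)
    have h3 := Osc_pos hμ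
    push_cast
    rw [abs_le]
    constructor <;> nlinarith
  -- The first letter b only chooses the initial state (b, `true`); the other n letters drive the
  -- chain.
  have h2 : ∑ w : Fin (n + 1) → Fin q, ((∏ i, weight μ (w i) : ℝ) : ℂ) *
      Complex.exp (Complex.I * t * c w) =
      ∑ b, (weight μ b : ℂ) * (twisted (weight μ) stepUp (centredPeak μ) t)^[n] 1 (b, true) := by
    rw [← (Fin.consEquiv fun _ => Fin q).sum_comp, Fintype.sum_prod_type]
    refine Finset.sum_congr rfl fun b _ => ?_
    rw [← sum_prod_mul_exp_pathSum, Finset.mul_sum]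
    refine Finset.sum_congr rfl fun w _ => ?_
    have htail : Fin.tail ((Fin.consEquiv fun _ => Fin q) (b, w)) = w := rfl
    simp only [hc, htail, Fin.consEquiv_apply, Fin.prod_univ_succ, Fin.cons_zero, Fin.cons_succ,
      Complex.ofReal_mul, mul_assoc]
  have h3 : ‖∑ b, (weight μ b : ℂ) *
      (twisted (weight μ) stepUp (centredPeak μ) t)^[n] 1 (b, true) - E‖ ≤
      C * (|t| + n * |t| ^ 3) := by
    have e : E = ∑ b, (weight μ b : ℂ) * E := by
      rw [← Finset.sum_mul, ← Complex.ofReal_sum, sum_weight, Complex.ofReal_one, one_mul]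
    rw [e, ← Finset.sum_sub_distrib]
    refine (norm_sum_le_of_le _ fun b _ => ?_).trans_eq
      (show ∑ b, weight μ b * (C * (|t| + n * |t| ^ 3)) = _ by
        rw [← Finset.sum_mul, sum_weight, one_mul])
    rw [← mul_sub, norm_mul, Complex.norm_real, Real.norm_of_nonneg (weight_nonneg b)]
    exact mul_le_mul_of_nonneg_left (hC t ht n _) (weight_nonneg b)
  rw [← h2] at h3
  refine (norm_sub_le_norm_sub_add_norm_sub _ _ _).trans ((add_le_add h1 h3).trans ?_)
  have : 0 ≤ (1 + Osc μ) * (n * |t| ^ 3) := by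
    have := Osc_pos hμ
    positivity
  linarith

/-- The characteristic function of the normalised length converges to the Gaussian one. -/
lemma tendsto_sum_exp (hμ : ∀ x, μ {x} ≠ 1) (s : ℝ) :
    Tendsto (fun n : ℕ => ∑ w : Fin (n + 1) → Fin q, ((∏ i, weight μ (w i) : ℝ) : ℂ) *
      Complex.exp (Complex.I * (s / (√((n + 1 : ℕ) : ℝ) * √(gammaSq μ)) : ℝ) *
        ((LA w : ℝ) - (n + 1 : ℕ) * Osc μ : ℝ))) atTop (nhds (Complex.exp (-s ^ 2 / 2))) := by
  obtain ⟨C, hC0, hC⟩ := exists_norm_sum_exp_sub_le hμ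
  have hγ := gammaSq_pos hμ
  set t : ℕ → ℝ := fun n => s / (√((n + 1 : ℕ) : ℝ) * √(gammaSq μ)) with ht
  have htlim : Tendsto t atTop (nhds 0) := by
    refine Tendsto.div_atTop tendsto_const_nhds ?_
    refine Tendsto.atTop_mul_const (Real.sqrt_pos.2 hγ) ?_
    exact Real.tendsto_sqrt_atTop.comp
      (tendsto_natCast_atTop_atTop.comp (tendsto_add_atTop_nat 1))
  have htsq : ∀ n, t n ^ 2 = s ^ 2 / ((n + 1 : ℕ) * gammaSq μ) := fun n => by
    rw [ht]
    simp only
    rw [div_pow, mul_pow, Real.sq_sqrt (by positivity), Real.sq_sqrt hγ.le]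
  have hratio : Tendsto (fun n : ℕ => (n : ℝ) / ((n + 1 : ℕ) : ℝ)) atTop (nhds 1) := by
    simpa using tendsto_natCast_div_add_atTop (1 : ℝ)
  have hpow : ∀ n : ℕ, Complex.exp (-((t n : ℂ) ^ 2 * gammaSq μ / 2)) ^ n =
      Complex.exp (((-s ^ 2 / 2 * ((n : ℝ) / ((n + 1 : ℕ) : ℝ)) : ℝ)) : ℂ) := fun n => by
    rw [← Complex.exp_nat_mul]
    congr 1
    have h := htsq n
    have h' : (n : ℝ) * (-(t n ^ 2 * gammaSq μ / 2)) =
        -s ^ 2 / 2 * ((n : ℝ) / ((n + 1 : ℕ) : ℝ)) := by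
      rw [h]
      field_simp
    rw [← h']
    push_cast
    rfl
  have hmain : Tendsto (fun n : ℕ => Complex.exp (-((t n : ℂ) ^ 2 * gammaSq μ / 2)) ^ n) atTop
      (nhds (Complex.exp (-s ^ 2 / 2))) := by
    simp only [hpow]
    have h1 := (hratio.const_mul (-s ^ 2 / 2))
    rw [mul_one] at h1
    have h2 := (Complex.continuous_exp.comp Complex.continuous_ofReal).continuousAt.tendsto.comp h1
    refine h2.trans_eq ?_
    simp
  have herr : Tendsto (fun n : ℕ => C * ((1 + s ^ 2 / gammaSq μ) * |t n|)) atTop (nhds 0) := by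
    have := ((htlim.abs.const_mul (1 + s ^ 2 / gammaSq μ)).const_mul C)
    simpa using this
  have hsmall : ∀ᶠ n in atTop, |t n| ≤ 1 := by
    have := htlim.abs
    rw [abs_zero] at this
    exact this.eventually_le_const one_pos
  have hdiff := squeeze_zero_norm' (hsmall.mono fun n hn => (hC (t n) hn n).trans ?_) herr
  · simpa only [sub_add_cancel, zero_add] using hdiff.add hmain
  · refine mul_le_mul_of_nonneg_left ?_ hC0
    -- Hence n|t|³ is at most a constant times |t|, and the whole error tends to 0 with t.
    have h1 : (n : ℝ) * |t n| ^ 2 ≤ s ^ 2 / gammaSq μ := by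
      rw [sq_abs, htsq, ← div_div, ← mul_div_assoc]
      refine div_le_div_of_nonneg_right ?_ hγ.le
      rw [← mul_div_assoc, div_le_iff₀ (by positivity)]
      push_cast
      nlinarith [sq_nonneg s]
    nlinarith [mul_le_mul_of_nonneg_right h1 (abs_nonneg (t n))]

lemma integral_word {Ω : Type*} [MeasurableSpace Ω] {P : Measure Ω} [IsProbabilityMeasure P]
    {n : ℕ} {a : Fin n → Ω → Fin q} (hindep : iIndepFun a P) (hlaw : ∀ i, HasLaw (a i) μ P)
    (g : (Fin n → Fin q) → ℂ) :
    ∫ ω, g (fun i => a i ω) ∂P = ∑ w, ((∏ i, weight μ (w i) : ℝ) : ℂ) * g w := by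
  have ha : ∀ i, AEMeasurable (a i) P := fun i => (hlaw i).aemeasurable
  have hmap : P.map (fun ω i => a i ω) = Measure.pi fun _ => μ := by
    rw [(iIndepFun_iff_map_fun_eq_pi_map ha).1 hindep]
    simp only [(hlaw _).map_eq]
  rw [← integral_map (φ := fun ω i => a i ω) (f := g) (aemeasurable_pi_lambda _ ha)
    (measurable_of_finite g).aestronglyMeasurable, hmap, integral_fintype .of_finite]
  refine Finset.sum_congr rfl fun w _ => ?_
  rw [measureReal_def, Measure.pi_singleton, ENNReal.toReal_prod, Complex.real_smul]
  rfl

end Limit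

end LongestAlternating

open LongestAlternating
theorem mainTheorem2 {q : ℕ} (μ : Measure (Fin q)) [IsProbabilityMeasure μ]
    (hμ : ∀ x, μ {x} ≠ 1)
    {Ω : ℕ → Type*} [∀ n, MeasurableSpace (Ω n)]
    (P : (n : ℕ) → Measure (Ω n)) [∀ n, IsProbabilityMeasure (P n)]
    (a : (n : ℕ) → Fin n → Ω n → Fin q)
    (ha_indep : ∀ n, iIndepFun (a n) (P n))
    (ha_law : ∀ n i, HasLaw (a n i) μ (P n))
    {Ω' : Type*} [MeasurableSpace Ω'] (P' : Measure Ω') [IsProbabilityMeasure P']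
    (Z : Ω' → ℝ) (hZ : HasLaw Z (gaussianReal 0 1) P') :
    Summable (fun k : ℕ => lagCov μ (k + 1)) ∧
    0 < gammaSq μ ∧
    TendstoInDistribution
      (fun (n : ℕ) (ω : Ω n) =>
        ((LA (fun i => a n i ω) : ℝ) - n * Osc μ) / (√(n : ℝ) * √(gammaSq μ)))
      atTop Z P P' := by
  -- In ℝ, `Summable` is unconditional and therefore absolute convergence.
  refine ⟨(hasSum_lagCov_succ hμ).summable, gammaSq_pos hμ, ?_⟩
  have hmeas : ∀ n, AEMeasurable (fun ω : Ω n =>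
      ((LA (fun i => a n i ω) : ℝ) - n * Osc μ) / (√(n : ℝ) * √(gammaSq μ))) (P n) := fun n =>
    (measurable_of_finite fun w : Fin n → Fin q =>
      ((LA w : ℝ) - n * Osc μ) / (√(n : ℝ) * √(gammaSq μ))).comp_aemeasurable
      (aemeasurable_pi_lambda _ fun i => (ha_law n i).aemeasurable)
  refine ⟨hmeas, hZ.aemeasurable, ?_⟩
  refine ProbabilityMeasure.tendsto_iff_tendsto_charFun.2 fun s => ?_
  rw! [hZ.map_eq]
  -- The empty word is discarded: the chain needs a first letter to start from.
  rw [← tendsto_add_atTop_iff_nat 1]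
  have hlim := tendsto_sum_exp hμ s
  have hg : charFun (gaussianReal 0 1) s = Complex.exp (-s ^ 2 / 2) := by
    rw [charFun_gaussianReal]
    congr 1
    simp [neg_div]
  simp only [ProbabilityMeasure.coe_mk, hg]
  refine hlim.congr fun n => ?_
  rw [charFun_apply_real, integral_map (hmeas _) (by fun_prop),
    ← integral_word (ha_indep (n + 1)) (ha_law (n + 1))]
  refine integral_congr_ae (.of_forall fun ω => ?_)
  simp only
  congr 1
  push_cast
  ring
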